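/- For a topological space $Z$, a continuous map $f\colon Z\to Z$ and $x\in Z$, the $\alpha$-limit set of $x$ is $\alpha_f(x)=\bigcap_{n\ge 0}\overline{\bigcup_{k\ge n} f^{-k}(x)}$. Call $Z$ an $\mathcal{AF}$-space if the closed subsets of $Z$ are exactly the sets $\alpha_f(x)$, where $f\colon Z\to Z$ is continuous and $x\in Z$. Let $S=\{(x,\sin\frac1x): 0<x\le \frac2\pi\}\subset\mathbb R^2$, let $\overline S$ be its closure (the closed topologist's sine curve), and let $X=\overline S\cup\{(x,-1): -1\le x\le 0\}$ (the extended sine curve). A chain of sine curves is a Hausdorff space $Y$ which is the union of a sequence $C_1,C_2,\dots$ of homeomorphic copies of $\overline S$ and a point $s_\infty$ belonging to none of them, such that every neighbourhood of $s_\infty$ contains all but finitely many $C_i$, such that $C_i\cap C_j=\emptyset$ whenever $|i-j|\ge 2$, and such that for each $i$ the set $C_i\cap C_{i+1}$ is a single point $b_i$, which corresponds in $C_i$ to one of the points $(0,1)$, $(0,-1)$ of $\overline S$ and in $C_{i+1}$ to the point $(\frac2\pi,1)$ of $\overline S$. Theorem. There exist two compact metrizable $\mathcal{AF}$-spaces whose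 product is not an $\mathcal{AF}$-space. More precisely, write $Z\oplus\{p\}$ for the topological sum of $Z$ and a one-point space. Chains of sine curves exist (even as subspaces of $\mathbb R^2$), and for every chain of sine curves $Y$ the spaces $X\oplus\{p\}$ and $Y\oplus\{p\}$ are compact metrizable $\mathcal{AF}$-spaces, while their product $(X\oplus\{p\})\times(Y\oplus\{p\})$ is not an $\mathcal{AF}$-space. -/

import Mathlib

/-- The `α`-limit set of `x` under `f`: the intersection over `n` of the closures of
the unions of the iterated preimages of `x` of order at least `n`. -/
def alphaLimit {X : Type*} [TopologicalSpace X] (f : X → X) (x : X) : Set X :=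
  ⋂ n : ℕ, closure (⋃ k : ℕ, ⋃ _ : n ≤ k, f^[k] ⁻¹' {x})

/-- `A` is an `α`-limit set in `X` if it is the `α`-limit set of some point of `X` under
some continuous self-map of `X`. -/
def IsAlphaLimitSet {X : Type*} [TopologicalSpace X] (A : Set X) : Prop :=
  ∃ f : X → X, Continuous f ∧ ∃ x : X, A = alphaLimit f x

/-- `X` is an `𝓐𝓕`-space if the family of `α`-limit sets in `X` coincides with the family
of closed sets in `X`. -/
def IsAFSpace (X : Type*) [TopologicalSpace X] : Prop :=
  {A : Set X | IsAlphaLimitSet A} = {A : Set X | IsClosed A}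

/-- The half-open sine curve `S = {(x, sin (1 / x)) : 0 < x ≤ 2 / π}` in the plane. -/
def sineCurve : Set (ℝ × ℝ) :=
  {q | 0 < q.1 ∧ q.1 ≤ 2 / Real.pi ∧ q.2 = Real.sin (1 / q.1)}

/-- The closed topologist's sine curve: the closure of `S` in the plane. -/
def closedSineCurve : Set (ℝ × ℝ) := closure sineCurve

/-- The extended sine curve: the closed topologist's sine curve together with the segment from
`b = (0, -1)` to `c = (-1, -1)`. -/
def extendedSineCurve : Set (ℝ × ℝ) :=
  closedSineCurve ∪ {q | -1 ≤ q.1 ∧ q.1 ≤ 0 ∧ q.2 = -1}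

theorem endpoint_mem_closedSineCurve : ((2 / Real.pi, 1) : ℝ × ℝ) ∈ closedSineCurve := by
  refine subset_closure ⟨by positivity, le_rfl, ?_⟩
  simp

theorem limit_mem_closedSineCurve (t : ℝ) (ht : Real.pi / 2 ≤ t) :
    ((0, Real.sin t) : ℝ × ℝ) ∈ closedSineCurve := by
  have hpi := Real.pi_pos
  have h1 : Filter.Tendsto (fun n : ℕ => t + (n : ℝ) * (2 * Real.pi)) Filter.atTop
      Filter.atTop :=
    Filter.tendsto_atTop_add_const_left _ _
      (tendsto_natCast_atTop_atTop.atTop_mul_const (by positivity))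
  have h2 : Filter.Tendsto
      (fun n : ℕ => ((t + (n : ℝ) * (2 * Real.pi))⁻¹, Real.sin t)) Filter.atTop
      (nhds ((0 : ℝ), Real.sin t)) :=
    (tendsto_inv_atTop_zero.comp h1).prodMk_nhds tendsto_const_nhds
  refine mem_closure_of_tendsto h2 (Filter.Eventually.of_forall fun n => ?_)
  have hn : (0 : ℝ) ≤ (n : ℝ) * (2 * Real.pi) := by positivity
  refine ⟨inv_pos.mpr (by linarith), ?_, ?_⟩
  · have h3 : (2 / Real.pi : ℝ) = (Real.pi / 2)⁻¹ := by rw [inv_div]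
    simp only [h3]
    exact inv_anti₀ (by positivity) (by linarith)
  · simp [Real.sin_add_nat_mul_two_pi]

theorem top_mem_closedSineCurve : ((0, 1) : ℝ × ℝ) ∈ closedSineCurve := by
  simpa using limit_mem_closedSineCurve (Real.pi / 2) le_rfl

theorem bottom_mem_closedSineCurve : ((0, -1) : ℝ × ℝ) ∈ closedSineCurve := by
  have h := limit_mem_closedSineCurve (Real.pi / 2 + Real.pi) (by linarith [Real.pi_pos])
  rwa [Real.sin_add_pi, Real.sin_pi_div_two] at h

namespace SineCurve

/-- The unique endpoint `(2 / π, 1)` of the half-open sine curve. -/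
noncomputable def endpoint : closedSineCurve := ⟨(2 / Real.pi, 1), endpoint_mem_closedSineCurve⟩

/-- The upper endpoint `(0, 1)` of the convergence continuum `{0} × [-1, 1]`. -/
def top : closedSineCurve := ⟨(0, 1), top_mem_closedSineCurve⟩

/-- The lower endpoint `(0, -1)` of the convergence continuum `{0} × [-1, 1]`. -/
def bottom : closedSineCurve := ⟨(0, -1), bottom_mem_closedSineCurve⟩

end SineCurve

/-- `Y` is a chain of sine curves: a Hausdorff space which is the union of topologically embedded
copies `e i` (`i = 0, 1, 2, …`) of the closed topologist's sine curve and one further point `s`,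
such that the copies converge to `s`, and are pairwise disjoint except that consecutive copies
`e i`, `e (i + 1)` meet in exactly one point `b i`, which is one of the two endpoints of the
convergence continuum of `e i` and is the endpoint of the half-open sine curve of `e (i + 1)`. -/
def IsChainOfSineCurves (Y : Type*) [TopologicalSpace Y] : Prop :=
  T2Space Y ∧
  ∃ (e : ℕ → closedSineCurve → Y) (b : ℕ → Y) (s : Y),
    (∀ i, Topology.IsEmbedding (e i)) ∧
    (∀ i, s ∉ Set.range (e i)) ∧
    ((⋃ i, Set.range (e i)) ∪ {s} = Set.univ) ∧
    (∀ U ∈ nhds s, ∃ N, ∀ i, N ≤ i → Set.range (e i) ⊆ U) ∧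
    (∀ i j, i + 2 ≤ j → Disjoint (Set.range (e i)) (Set.range (e j))) ∧
    (∀ i, Set.range (e i) ∩ Set.range (e (i + 1)) = {b i}) ∧
    (∀ i, b i = e i SineCurve.top ∨ b i = e i SineCurve.bottom) ∧
    (∀ i, b i = e (i + 1) SineCurve.endpoint)

/-! Positive half. With an isolated point added, it is enough that each nonempty closed `B` in the
original space is the `α`-limit set of a fixed point (`isAFSpace_sum_unit`). If some path leaves
`B`, follow it after its last visit to `B`, using the distance to `B` as time: every preimage of
positive order of the last point visited is exactly `B` (`isFixedAlphaLimitSet_of_joined`).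
Otherwise `B` is a union of path components, and being closed it can only be the whole space
(constant map), the limit point of a chain (identity), or one limit bar together with everything
attached beyond it. For the last kind, double phases along the sine curve. On the bar this is `t ↦
2t² - 1`, whose iterated preimages of the top are dense, while the oscillating part is mapped into
itself and never reaches the top (`isFixedAlphaLimitSet_bar_union`).

Negative half. Let `A` consist of the arc `extendedBar` in `X × {p}` and the point `s` in `{p} × Y`,
and suppose that `A` is the `α`-limit set of `w` under `f`. Both pieces are connected and clopen, so
`f` carries each of them into a single clopen piece. If `X` went to `Y`, the arc would go to `s`,
hence all of `X` would (`eq_limit_of_map_extendedBar`), and then no point of `X` could be left out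
of `A`. So `X` maps to itself by some `g`, `w` lies in `X`, and `Y` must map to `X` by some `φ`.

A tail of the chain is then sent into the arc. Late preimages of `w` under `g` lie in the arc
(`exists_preimage_subset_extendedBar`) and accumulate at all of its points. If `φ` is not constant
on a finite stretch of the chain, the image of that stretch contains a subarc and so meets preimages
of arbitrarily high order; if `φ` is constant on the whole tail, any hit near `s` is a hit
everywhere on the tail. Both produce accumulation in `Y` away from `s` (`false_of_accSet_eq_limit`).
-/

section

open Set Filter Topology TopologicalSpace

/-- The set of points all of whose neighbourhoods meet infinitely many of the sets `E k`. -/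
def accSet {Z : Type*} [TopologicalSpace Z] (E : ℕ → Set Z) : Set Z :=
  ⋂ n : ℕ, closure (⋃ k : ℕ, ⋃ _ : n ≤ k, E k)

/-! ### Accumulation of sets of preimages, and `α`-limit sets of fixed points -/

section AccSet

variable {Z : Type*} [TopologicalSpace Z]

theorem mem_accSet {E : ℕ → Set Z} {z : Z} :
    z ∈ accSet E ↔ ∀ U ∈ 𝓝 z, ∀ n, ∃ k, n ≤ k ∧ ∃ u ∈ U, u ∈ E k := by
  simp only [accSet, mem_iInter, mem_closure_iff_nhds]
  constructor
  · intro h U hU n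
    obtain ⟨u, huU, hu⟩ := h n U hU
    simp only [mem_iUnion] at hu
    obtain ⟨k, hk, hu⟩ := hu
    exact ⟨k, hk, u, huU, hu⟩
  · intro h n U hU
    obtain ⟨k, hk, u, huU, hu⟩ := h U hU n
    exact ⟨u, huU, by simp only [mem_iUnion]; exact ⟨k, hk, hu⟩⟩

theorem alphaLimit_eq_accSet (f : Z → Z) (x : Z) :
    alphaLimit f x = accSet (fun k => f^[k] ⁻¹' {x}) := rfl

theorem mem_alphaLimit {f : Z → Z} {x z : Z} :
    z ∈ alphaLimit f x ↔ ∀ U ∈ 𝓝 z, ∀ n, ∃ k, n ≤ k ∧ ∃ u ∈ U, f^[k] u = x := by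
  rw [alphaLimit_eq_accSet, mem_accSet]; rfl

theorem isClosed_alphaLimit (f : Z → Z) (x : Z) : IsClosed (alphaLimit f x) :=
  isClosed_iInter fun _ => isClosed_closure

/-- Each point of `K` has a neighbourhood missed by all late `E k`, and finitely many of these cover
`K`. This is how "not in the `α`-limit set" is used on whole paths and finite stretches of a chain.
-/
theorem IsCompact.eventually_disjoint_of_accSet {E : ℕ → Set Z} {K : Set Z} (hK : IsCompact K)
    (h : Disjoint K (accSet E)) : ∃ n, ∀ k, n ≤ k → Disjoint K (E k) := by
  refine hK.induction_on (p := fun s => ∃ n, ∀ k, n ≤ k → Disjoint s (E k)) ?_ ?_ ?_ ?_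
  · exact ⟨0, fun k _ => empty_disjoint _⟩
  · rintro s t hst ⟨n, hn⟩
    exact ⟨n, fun k hk => (hn k hk).mono_left hst⟩
  · rintro s t ⟨n, hn⟩ ⟨m, hm⟩
    exact ⟨max n m, fun k hk => disjoint_union_left.2
      ⟨hn k (le_trans (le_max_left _ _) hk), hm k (le_trans (le_max_right _ _) hk)⟩⟩
  · intro z hz
    have hz' : z ∉ accSet E := disjoint_left.1 h hz
    rw [mem_accSet] at hz'
    push Not at hz'
    obtain ⟨U, hU, n, hn⟩ := hz'
    exact ⟨U, mem_nhdsWithin_of_mem_nhds hU, n,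
      fun k hk => disjoint_left.2 fun u hu => hn k hk u hu⟩

theorem mapsTo_alphaLimit {f : Z → Z} (hf : Continuous f) {x : Z} :
    MapsTo f (alphaLimit f x) (alphaLimit f x) := by
  intro z hz
  rw [mem_alphaLimit] at hz ⊢
  intro U hU n
  obtain ⟨k, hk, u, hu, hx⟩ := hz (f ⁻¹' U) (hf.continuousAt hU) (n + 1)
  obtain ⟨m, rfl⟩ : ∃ m, k = m + 1 := ⟨k - 1, by omega⟩
  exact ⟨m, by omega, f u, hu, by simpa using hx⟩

/-- `B` is the `α`-limit set of a fixed point of a continuous self-map. -/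
def IsFixedAlphaLimitSet (B : Set Z) : Prop :=
  ∃ f : Z → Z, Continuous f ∧ ∃ x : Z, f x = x ∧ alphaLimit f x = B

theorem alphaLimit_eq_of_preimage {f : Z → Z} {x : Z} {B : Set Z} (hB : IsClosed B)
    (h : ∀ k, 1 ≤ k → f^[k] ⁻¹' {x} = B) : alphaLimit f x = B := by
  ext z
  rw [mem_alphaLimit]
  constructor
  · intro hz
    refine hB.closure_subset (mem_closure_iff_nhds.2 fun U hU => ?_)
    obtain ⟨k, hk, u, hu, hx⟩ := hz U hU 1
    exact ⟨u, hu, by rw [← h k hk]; exact hx⟩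
  · intro hz U hU n
    refine ⟨n + 1, by omega, z, mem_of_mem_nhds hU, ?_⟩
    rw [← h (n + 1) (by omega)] at hz
    exact hz

theorem isFixedAlphaLimitSet_univ [Nonempty Z] : IsFixedAlphaLimitSet (univ : Set Z) := by
  obtain ⟨x⟩ := ‹Nonempty Z›
  refine ⟨fun _ => x, continuous_const, x, rfl, alphaLimit_eq_of_preimage isClosed_univ ?_⟩
  intro k hk
  obtain ⟨m, rfl⟩ : ∃ m, k = m + 1 := ⟨k - 1, by omega⟩
  ext z
  simp only [mem_preimage, mem_singleton_iff, mem_univ, Function.iterate_succ_apply']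

theorem isFixedAlphaLimitSet_singleton [T1Space Z] (x : Z) :
    IsFixedAlphaLimitSet ({x} : Set Z) :=
  ⟨id, continuous_id, x, rfl, alphaLimit_eq_of_preimage isClosed_singleton fun k _ => by simp⟩

/-- A closed set that can be left along a path is the `α`-limit set of a fixed point. -/
theorem isFixedAlphaLimitSet_of_joined [MetrizableSpace Z] {B : Set Z} (hB : IsClosed B)
    {u v : Z} (hu : u ∈ B) (hv : v ∉ B) (huv : Joined u v) : IsFixedAlphaLimitSet B := by
  let _ := metrizableSpaceMetric Z
  obtain ⟨γ⟩ := huv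
  let F : Set unitInterval := γ ⁻¹' B
  have hF : IsCompact F := (hB.preimage γ.continuous).isCompact
  -- The last time at which the path is in `B`; its position is the fixed point.
  obtain ⟨t₀, ht₀, hmax⟩ := hF.exists_isGreatest ⟨0, by simp [F, hu]⟩
  have ht1 : (t₀ : ℝ) < 1 := by
    refine lt_of_le_of_ne t₀.2.2 fun h => hv ?_
    have : t₀ = 1 := Subtype.ext h
    subst this
    simpa [F] using ht₀
  -- The path restarted at `t₀`, with the parameter capped so that it stops at time `1`; for
  -- positive `d` it is off `B`.
  let η : ℝ → Z := fun d => γ (projIcc 0 1 zero_le_one (t₀ + min d (1 - t₀)))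
  have hη : Continuous η := by
    refine γ.continuous.comp (continuous_projIcc.comp ?_)
    fun_prop
  have hη0 : η 0 = γ t₀ := by
    have h0 : min (0 : ℝ) (1 - t₀) = 0 := min_eq_left (by linarith)
    simp [η, h0]
  have hηpos : ∀ d, 0 < d → η d ∉ B := by
    intro d hd hB'
    have hle := hmax hB'
    have hm : 0 < min d (1 - (t₀ : ℝ)) := lt_min hd (by linarith)
    have hm' : min d (1 - (t₀ : ℝ)) ≤ 1 - t₀ := min_le_right _ _
    rw [← Subtype.coe_le_coe, projIcc_of_mem _ ⟨by linarith [t₀.2.1], by linarith⟩] at hle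
    simp only at hle
    linarith
  have hne : B.Nonempty := ⟨u, hu⟩
  let f : Z → Z := fun z => η (Metric.infDist z B)
  have hfB : ∀ z, z ∈ B → f z = γ t₀ := fun z hz => by
    simp [f, Metric.infDist_zero_of_mem hz, hη0]
  have hfn : ∀ z, z ∉ B → f z ∉ B := fun z hz => hηpos _ ((hB.notMem_iff_infDist_pos hne).1 hz)
  refine ⟨f, hη.comp (Metric.continuous_infDist_pt B), γ t₀, hfB _ ht₀,
    alphaLimit_eq_of_preimage hB ?_⟩
  intro k hk
  obtain ⟨m, rfl⟩ : ∃ m, k = m + 1 := ⟨k - 1, by omega⟩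
  ext z
  simp only [mem_preimage, mem_singleton_iff]
  constructor
  · intro h
    by_contra hz
    have key : ∀ j, f^[j] z ∉ B := by
      intro j
      induction j with
      | zero => exact hz
      | succ j ih => rw [Function.iterate_succ_apply']; exact hfn _ ih
    exact key (m + 1) (h ▸ ht₀)
  · intro hz
    induction m with
    | zero => exact hfB z hz
    | succ m ih =>
      rw [Function.iterate_succ_apply', ih (by omega)]
      exact hfB _ ht₀

end AccSet

/-! ### Adding an isolated point -/

section SumUnit

variable {Z : Type*} [TopologicalSpace Z]

/-- An open piece that is mapped into itself sees all of its points' orbits, and its neighbourhoods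
are neighbourhoods in the whole space. -/
theorem preimage_alphaLimit_of_isOpenEmbedding {W : Type*} [TopologicalSpace W] {ι : Z → W}
    (hι : IsOpenEmbedding ι) {f : W → W} {g : Z → Z} (h : ∀ z, f (ι z) = ι (g z)) (x : Z) :
    ι ⁻¹' alphaLimit f (ι x) = alphaLimit g x := by
  have hk : ∀ k z, f^[k] (ι z) = ι (g^[k] z) := fun k z =>
    ((show Function.Semiconj ι g f from fun z => (h z).symm).iterate_right k z).symm
  ext z
  rw [mem_preimage, mem_alphaLimit, mem_alphaLimit]
  constructor
  · intro hz U hU n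
    obtain ⟨k, hkn, _, ⟨u, hu, rfl⟩, hx⟩ := hz (ι '' U) (hι.isOpenMap.image_mem_nhds hU) n
    rw [hk] at hx
    exact ⟨k, hkn, u, hu, hι.injective hx⟩
  · intro hz U hU n
    obtain ⟨k, hkn, u, hu, hx⟩ := hz (ι ⁻¹' U) (hι.continuous.continuousAt hU) n
    exact ⟨k, hkn, ι u, hu, by rw [hk, hx]⟩

theorem isAlphaLimitSet_sum_unit {B : Set (Z ⊕ Unit)}
    (hB : IsFixedAlphaLimitSet (Sum.inl ⁻¹' B)) : IsAlphaLimitSet B := by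
  classical
  obtain ⟨g, hg, x, hx, hgB⟩ := hB
  -- Since `x` is fixed, an isolated point sent to `x` is a preimage of `x` of every positive order;
  -- left fixed, it is a preimage of none.
  let y : Z ⊕ Unit := if Sum.inr () ∈ B then Sum.inl x else Sum.inr ()
  let f : Z ⊕ Unit → Z ⊕ Unit := Sum.elim (fun z => Sum.inl (g z)) (fun _ => y)
  have hf : Continuous f :=
    Continuous.sumElim (continuous_inl.comp hg) continuous_const
  refine ⟨f, hf, Sum.inl x, ?_⟩
  have h1 : Sum.inl ⁻¹' alphaLimit f (Sum.inl x) = alphaLimit g x :=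
    preimage_alphaLimit_of_isOpenEmbedding IsOpenEmbedding.inl (fun z => rfl) x
  have hfix : ∀ k, f^[k] (Sum.inl x) = Sum.inl x := fun k =>
    Function.iterate_fixed (show f (Sum.inl x) = Sum.inl x by simp [f, hx]) k
  ext z
  rcases z with z | ⟨⟨⟩⟩
  · have := Set.ext_iff.1 (h1.trans hgB) z
    exact this.symm
  · by_cases hp : Sum.inr () ∈ B
    · simp only [hp, true_iff]
      rw [mem_alphaLimit]
      intro U hU n
      refine ⟨n + 1, by omega, Sum.inr (), mem_of_mem_nhds hU, ?_⟩
      rw [Function.iterate_succ_apply]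
      have : f (Sum.inr ()) = Sum.inl x := by simp [f, y, hp]
      rw [this, hfix]
    · simp only [hp, false_iff]
      rw [mem_alphaLimit]
      intro h
      have hU : ({Sum.inr ()} : Set (Z ⊕ Unit)) ∈ 𝓝 (Sum.inr ()) := by
        have : IsOpen (range (Sum.inr : Unit → Z ⊕ Unit)) := isOpen_range_inr
        refine mem_of_superset (this.mem_nhds ⟨(), rfl⟩) ?_
        rintro _ ⟨⟨⟩, rfl⟩
        rfl
      obtain ⟨k, -, u, rfl, hk⟩ := h _ hU 0
      have : f (Sum.inr ()) = Sum.inr () := by simp [f, y, hp]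
      rw [Function.iterate_fixed this] at hk
      exact absurd hk (by simp)

theorem isAFSpace_sum_unit [T1Space Z] [Nonempty Z]
    (h : ∀ B : Set Z, IsClosed B → B.Nonempty → IsFixedAlphaLimitSet B) :
    IsAFSpace (Z ⊕ Unit) := by
  ext B
  constructor
  · rintro ⟨f, -, x, rfl⟩
    exact isClosed_alphaLimit f x
  · intro hB
    have hBZ : IsClosed (Sum.inl ⁻¹' B : Set Z) := (isClosed_sum_iff.1 hB).1
    rcases (Sum.inl ⁻¹' B : Set Z).eq_empty_or_nonempty with he | hne
    · by_cases hp : Sum.inr () ∈ B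
      · have hB' : B = {Sum.inr ()} := by
          ext z
          rcases z with z | ⟨⟨⟩⟩
          · have := Set.ext_iff.1 he z
            simpa using this
          · simpa using hp
        refine ⟨id, continuous_id, Sum.inr (), ?_⟩
        exact (alphaLimit_eq_of_preimage hB fun k _ => by simp [hB']).symm
      · have hB' : B = ∅ := by
          ext z
          rcases z with z | ⟨⟨⟩⟩
          · have := Set.ext_iff.1 he z
            simpa using this
          · simpa using hp
        obtain ⟨x⟩ := ‹Nonempty Z›
        -- The chosen point is outside the image of this map, so it has no preimages of positive
        -- order.
        refine ⟨fun _ => Sum.inr (), continuous_const, Sum.inl x, ?_⟩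
        rw [hB', alphaLimit_eq_of_preimage isClosed_empty]
        intro k hk
        obtain ⟨m, rfl⟩ : ∃ m, k = m + 1 := ⟨k - 1, by omega⟩
        ext z
        simp only [mem_preimage, mem_singleton_iff, Function.iterate_succ_apply',
          mem_empty_iff_false, iff_false]
        exact Sum.inr_ne_inl
    · exact isAlphaLimitSet_sum_unit (h _ hBZ hne)

end SumUnit

/-! ### Path components of the sine curves -/

section Plane

theorem isClosed_closedSineCurve : IsClosed closedSineCurve := isClosed_closure

theorem closedSineCurve_subset_box :
    closedSineCurve ⊆ Icc (0 : ℝ) (2 / Real.pi) ×ˢ Icc (-1 : ℝ) 1 := by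
  refine closure_minimal ?_ (isClosed_Icc.prod isClosed_Icc)
  rintro q ⟨h1, h2, h3⟩
  exact ⟨⟨h1.le, h2⟩, h3 ▸ Real.neg_one_le_sin _, h3 ▸ Real.sin_le_one _⟩

theorem isCompact_closedSineCurve : IsCompact closedSineCurve :=
  (isCompact_Icc.prod isCompact_Icc).of_isClosed_subset isClosed_closedSineCurve
    closedSineCurve_subset_box

theorem mem_sineCurve_of_pos {q : ℝ × ℝ} (hq : q ∈ closedSineCurve) (h : 0 < q.1) :
    q ∈ sineCurve := by
  refine ⟨h, (closedSineCurve_subset_box hq).1.2, ?_⟩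
  obtain ⟨u, hu, hlim⟩ := mem_closure_iff_seq_limit.1 hq
  have h1 : Tendsto (fun n => (u n).1) atTop (𝓝 q.1) := (continuous_fst.tendsto q).comp hlim
  have h2 : Tendsto (fun n => (u n).2) atTop (𝓝 q.2) := (continuous_snd.tendsto q).comp hlim
  have h3 : Tendsto (fun n => Real.sin (1 / (u n).1)) atTop (𝓝 (Real.sin (1 / q.1))) :=
    (Real.continuous_sin.tendsto _).comp (tendsto_const_nhds.div h1 h.ne')
  refine tendsto_nhds_unique h2 (h3.congr fun n => ?_)
  exact (hu n).2.2.symm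

theorem zero_mem_closedSineCurve {t : ℝ} (h1 : -1 ≤ t) (h2 : t ≤ 1) :
    ((0, t) : ℝ × ℝ) ∈ closedSineCurve := by
  have h := limit_mem_closedSineCurve (Real.arcsin t + 2 * Real.pi)
    (by linarith [Real.neg_pi_div_two_le_arcsin t, Real.pi_pos])
  rwa [Real.sin_add_two_pi, Real.sin_arcsin h1 h2] at h

theorem closedSineCurve_subset_extended : closedSineCurve ⊆ extendedSineCurve :=
  subset_union_left

theorem isCompact_extendedSineCurve : IsCompact extendedSineCurve := by
  refine isCompact_closedSineCurve.union ?_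
  have : {q : ℝ × ℝ | -1 ≤ q.1 ∧ q.1 ≤ 0 ∧ q.2 = -1} = Icc (-1 : ℝ) 0 ×ˢ {(-1 : ℝ)} := by
    ext q
    simp [and_assoc]
  rw [this]
  exact isCompact_Icc.prod isCompact_singleton

theorem extendedSineCurve_cases {q : ℝ × ℝ} (hq : q ∈ extendedSineCurve) :
    q ∈ sineCurve ∨ (q.1 = 0 ∧ -1 ≤ q.2 ∧ q.2 ≤ 1) ∨ (-1 ≤ q.1 ∧ q.1 ≤ 0 ∧ q.2 = -1) := by
  rcases hq with hq | hq
  · have hb := closedSineCurve_subset_box hq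
    rcases hb.1.1.eq_or_lt with h | h
    · exact Or.inr (Or.inl ⟨h.symm, hb.2⟩)
    · exact Or.inl (mem_sineCurve_of_pos hq h)
  · exact Or.inr (Or.inr hq)

theorem mem_sineCurve_of_pos_extended {q : ℝ × ℝ} (hq : q ∈ extendedSineCurve) (h : 0 < q.1) :
    q ∈ sineCurve := by
  rcases extendedSineCurve_cases hq with h1 | h1 | h1
  · exact h1
  · linarith [h1.1]
  · linarith [h1.2.1]

/-- The sine curve oscillates too much for a connected set of small height that reaches its limit
bar to contain any of its points. -/
theorem fst_nonpos_of_isPreconnected {α : Type*} [TopologicalSpace α] {D : Set α}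
    (hD : IsPreconnected D) {ψ : α → ℝ × ℝ} (hψ : Continuous ψ)
    (hmem : ∀ d ∈ D, ψ d ∈ extendedSineCurve) {d₀ : α} (hd₀ : d₀ ∈ D) (h₀ : (ψ d₀).1 ≤ 0)
    (hosc : ∀ d ∈ D, |(ψ d).2 - (ψ d₀).2| < 1 / 2) : ∀ d ∈ D, (ψ d).1 ≤ 0 := by
  intro d hd
  by_contra! hpos
  have hpi := Real.pi_pos
  -- A phase at which the sine is `1` or `-1`, with sign opposite to the starting height; adding
  -- full periods brings its abscissa as close to the bar as desired.
  obtain ⟨θ₀, hθ₀, hsin⟩ : ∃ θ₀ : ℝ, 0 < θ₀ ∧ 1 ≤ |Real.sin θ₀ - (ψ d₀).2| := by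
    rcases le_total (ψ d₀).2 0 with h | h
    · refine ⟨Real.pi / 2, by positivity, ?_⟩
      rw [Real.sin_pi_div_two]
      exact le_trans (by linarith) (le_abs_self _)
    · refine ⟨Real.pi / 2 + Real.pi, by positivity, ?_⟩
      rw [Real.sin_add_pi, Real.sin_pi_div_two]
      exact le_trans (by linarith) (neg_le_abs _)
  obtain ⟨n, hn⟩ := exists_nat_gt (1 / (ψ d).1)
  have hn0 : (0 : ℝ) ≤ n := n.cast_nonneg
  set θ : ℝ := θ₀ + n * (2 * Real.pi) with hθ
  have hθn : (n : ℝ) < θ := by nlinarith [Real.pi_gt_three]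
  have hθpos : 0 < θ := by linarith
  have hlt : 1 / θ < (ψ d).1 := by
    rw [div_lt_iff₀ hθpos]
    rw [div_lt_iff₀ hpos] at hn
    nlinarith
  have hIVT : 1 / θ ∈ (fun d => (ψ d).1) '' D :=
    hD.intermediate_value hd₀ hd (continuous_fst.comp hψ).continuousOn
      ⟨h₀.trans (by positivity), hlt.le⟩
  obtain ⟨d', hd', h'⟩ := hIVT
  simp only at h'
  have hq := (mem_sineCurve_of_pos_extended (hmem d' hd') (by rw [h']; positivity)).2.2
  have hθ' : (ψ d').2 = Real.sin θ₀ := by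
    rw [hq, h', one_div_one_div, hθ, Real.sin_add_nat_mul_two_pi]
  have := hosc d' hd'
  rw [hθ'] at this
  linarith

/-- Along a path, being on the left part is a closed condition, and by small oscillation also an
open one. -/
theorem fst_nonpos_of_path {u v : extendedSineCurve} (h : Joined u v) (hu : u.1.1 ≤ 0) :
    v.1.1 ≤ 0 := by
  obtain ⟨γ⟩ := h
  let ψ : ℝ → ℝ × ℝ := fun t => (γ.extend t).1
  have hψ : Continuous ψ := continuous_subtype_val.comp γ.continuous_extend
  have hmem : ∀ t, ψ t ∈ extendedSineCurve := fun t => (γ.extend t).2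
  have hclopen : IsClopen {t | (ψ t).1 ≤ 0} := by
    refine ⟨isClosed_le (continuous_fst.comp hψ) continuous_const, ?_⟩
    rw [isOpen_iff_mem_nhds]
    intro t ht
    have hO : IsOpen {r | |(ψ r).2 - (ψ t).2| < 1 / 2} :=
      isOpen_lt (by fun_prop) continuous_const
    obtain ⟨ε, hε, hball⟩ := Metric.isOpen_iff.1 hO t (by simp)
    refine mem_of_superset (Metric.ball_mem_nhds t hε) ?_
    exact fst_nonpos_of_isPreconnected (convex_ball t ε).isPreconnected hψ
      (fun r _ => hmem r) (Metric.mem_ball_self hε) ht (fun r hr => hball hr)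
  have huniv := hclopen.eq_univ ⟨0, by simpa [ψ] using hu⟩
  have h1 : (1 : ℝ) ∈ {t | (ψ t).1 ≤ 0} := huniv ▸ mem_univ _
  simpa [ψ] using h1

theorem isPathConnected_sineCurve : IsPathConnected sineCurve := by
  have hpi := Real.pi_pos
  have himg : sineCurve = (fun a : ℝ => (a, Real.sin (1 / a))) '' Ioc 0 (2 / Real.pi) := by
    ext q
    constructor
    · rintro ⟨h1, h2, h3⟩
      exact ⟨q.1, ⟨h1, h2⟩, Prod.ext rfl h3.symm⟩
    · rintro ⟨a, ha, rfl⟩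
      exact ⟨ha.1, ha.2, rfl⟩
  rw [himg]
  refine ((convex_Ioc _ _).isPathConnected ⟨2 / Real.pi, by positivity, le_rfl⟩).image' ?_
  intro a ha
  have : ContinuousAt (fun a : ℝ => (a, Real.sin (1 / a))) a := by
    refine continuousAt_id.prodMk (Real.continuous_sin.continuousAt.comp ?_)
    exact continuousAt_const.div continuousAt_id ha.1.ne'
  exact this.continuousWithinAt

theorem isPathConnected_limitBar :
    IsPathConnected ({0} ×ˢ Icc (-1) 1 : Set (ℝ × ℝ)) :=
  ((convex_singleton _).prod (convex_Icc _ _)).isPathConnected ⟨(0, 0), by simp⟩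

theorem limitBar_subset : ({0} ×ˢ Icc (-1) 1 : Set (ℝ × ℝ)) ⊆ closedSineCurve := by
  rintro ⟨a, t⟩ ⟨h1, h2⟩
  obtain rfl : a = 0 := h1
  exact zero_mem_closedSineCurve h2.1 h2.2

theorem sineCurve_subset : sineCurve ⊆ closedSineCurve := subset_closure

theorem joined_of_joinedIn {X : Type*} [TopologicalSpace X] {F G : Set X} (hFG : F ⊆ G)
    {x y : G} (h : JoinedIn F x y) : Joined x y := by
  have := h.mono hFG
  exact this.joined_subtype

theorem joined_of_pos {u v : closedSineCurve} (hu : 0 < u.1.1) (hv : 0 < v.1.1) : Joined u v :=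
  joined_of_joinedIn sineCurve_subset (isPathConnected_sineCurve.joinedIn _
    (mem_sineCurve_of_pos u.2 hu) _ (mem_sineCurve_of_pos v.2 hv))

theorem fst_nonneg (u : closedSineCurve) : 0 ≤ u.1.1 := (closedSineCurve_subset_box u.2).1.1

theorem joined_of_zero {u v : closedSineCurve} (hu : u.1.1 = 0) (hv : v.1.1 = 0) : Joined u v :=
  joined_of_joinedIn limitBar_subset (isPathConnected_limitBar.joinedIn _
    ⟨hu, (closedSineCurve_subset_box u.2).2⟩ _ ⟨hv, (closedSineCurve_subset_box v.2).2⟩)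

/-- The inclusion of the closed sine curve into the extended one. -/
def sineInclusion : closedSineCurve → extendedSineCurve :=
  fun u => ⟨u.1, closedSineCurve_subset_extended u.2⟩

theorem continuous_sineInclusion : Continuous sineInclusion :=
  continuous_subtype_val.subtype_mk _

theorem fst_eq_zero_of_joined {u v : closedSineCurve} (h : Joined u v) (hu : u.1.1 = 0) :
    v.1.1 = 0 :=
  le_antisymm (fst_nonpos_of_path (h.map continuous_sineInclusion) (u := sineInclusion u)
    (v := sineInclusion v) hu.le) (fst_nonneg v)

theorem dense_pos : Dense {u : closedSineCurve | 0 < u.1.1} := by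
  intro u
  rw [closure_subtype]
  refine closure_mono ?_ u.2
  intro q hq
  exact ⟨⟨q, sineCurve_subset hq⟩, hq.1, rfl⟩

end Plane

/-! ### Phase doubling and the limit bar -/

section Doubling

/-- The map `(a, t) ↦ (2a / (4 - πa), 2t² - 1)`, which doubles phases along the sine curve. -/
noncomputable def planeDouble (q : ℝ × ℝ) : ℝ × ℝ :=
  (2 * max q.1 0 / (4 - Real.pi * max q.1 0), 2 * q.2 ^ 2 - 1)

/-- In the phase `θ = 1 / a` the first coordinate becomes `θ ↦ 2θ - π / 2`, and `sin (2θ - π / 2) =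
2 sin² θ - 1`. The shift by `π / 2` makes the endpoint phase `π / 2` fixed, which later allows
gluing with the identity on earlier copies. -/
theorem planeDouble_mem_sineCurve {q : ℝ × ℝ} (hq : q ∈ sineCurve) :
    planeDouble q ∈ sineCurve := by
  obtain ⟨a, t⟩ := q
  obtain ⟨h1, h2, h3⟩ := hq
  simp only at h1 h2 h3
  have hpi := Real.pi_pos
  rw [le_div_iff₀ hpi] at h2
  have hden : 0 < 4 - Real.pi * a := by linarith
  simp only [planeDouble, max_eq_left h1.le]
  refine ⟨by simp only; positivity, ?_, ?_⟩
  · simp only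
    rw [div_le_div_iff₀ hden hpi]
    nlinarith
  · simp only
    have : 1 / (2 * a / (4 - Real.pi * a)) = 2 * (1 / a) - Real.pi / 2 := by
      field_simp
      ring
    rw [this, Real.sin_sub_pi_div_two, Real.cos_two_mul, h3, Real.sin_sq]
    ring

theorem planeDouble_of_nonpos {q : ℝ × ℝ} (hq : q.1 ≤ 0) :
    planeDouble q = (0, 2 * q.2 ^ 2 - 1) := by
  simp [planeDouble, max_eq_right hq]

theorem planeDouble_mem {q : ℝ × ℝ} (hq : q ∈ extendedSineCurve) :
    planeDouble q ∈ closedSineCurve := by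
  rcases extendedSineCurve_cases hq with h | h | h
  · exact sineCurve_subset (planeDouble_mem_sineCurve h)
  · rw [planeDouble_of_nonpos h.1.le]
    exact zero_mem_closedSineCurve (by nlinarith) (by nlinarith)
  · rw [planeDouble_of_nonpos h.2.1, h.2.2]
    exact zero_mem_closedSineCurve (by norm_num) (by norm_num)

theorem continuousOn_planeDouble : ContinuousOn planeDouble extendedSineCurve := by
  have hpi := Real.pi_pos
  refine ContinuousOn.prodMk (ContinuousOn.div (by fun_prop) (by fun_prop) ?_) (by fun_prop)
  intro q hq
  have : Real.pi * max q.1 0 ≤ 2 := by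
    have h2 : max q.1 0 ≤ 2 / Real.pi := by
      refine max_le ?_ (by positivity)
      rcases extendedSineCurve_cases hq with h | h | h
      · exact h.2.1
      · rw [h.1]; positivity
      · exact h.2.1.trans (by positivity)
    rw [le_div_iff₀ hpi] at h2
    linarith
  linarith

/-- The phase doubling map of the closed sine curve. -/
noncomputable def sineDouble (u : closedSineCurve) : closedSineCurve :=
  ⟨planeDouble u, planeDouble_mem (closedSineCurve_subset_extended u.2)⟩

theorem continuous_sineDouble : Continuous sineDouble :=
  Continuous.subtype_mk ((continuousOn_planeDouble.mono
    closedSineCurve_subset_extended).comp_continuous continuous_subtype_val fun u => u.2) _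

/-- The phase doubling map of the extended sine curve, which collapses the added segment. -/
noncomputable def extendedDouble (u : extendedSineCurve) : extendedSineCurve :=
  ⟨planeDouble u, closedSineCurve_subset_extended (planeDouble_mem u.2)⟩

theorem continuous_extendedDouble : Continuous extendedDouble :=
  Continuous.subtype_mk (continuousOn_planeDouble.comp_continuous
    continuous_subtype_val fun u => u.2) _

theorem sineDouble_pos {u : closedSineCurve} (hu : 0 < u.1.1) : 0 < (sineDouble u).1.1 :=
  (planeDouble_mem_sineCurve (mem_sineCurve_of_pos u.2 hu)).1

theorem sineDouble_top : sineDouble SineCurve.top = SineCurve.top := by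
  apply Subtype.ext
  simp [sineDouble, SineCurve.top, planeDouble]
  norm_num

theorem sineDouble_bottom : sineDouble SineCurve.bottom = SineCurve.top := by
  apply Subtype.ext
  simp [sineDouble, SineCurve.top, SineCurve.bottom, planeDouble]
  norm_num

theorem sineDouble_endpoint : sineDouble SineCurve.endpoint = SineCurve.endpoint := by
  apply Subtype.ext
  have hpi := Real.pi_pos
  have h : max (2 / Real.pi) 0 = 2 / Real.pi := max_eq_left (by positivity)
  simp only [sineDouble, SineCurve.endpoint, planeDouble, h]
  ext
  · simp only
    field_simp
    norm_num
  · norm_num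

/-- The point of the limit bar at height `cos θ`. -/
noncomputable def barPoint (θ : ℝ) : closedSineCurve :=
  ⟨(0, Real.cos θ), zero_mem_closedSineCurve (Real.neg_one_le_cos θ) (Real.cos_le_one θ)⟩

theorem continuous_barPoint : Continuous barPoint :=
  Continuous.subtype_mk (continuous_const.prodMk Real.continuous_cos) _

theorem sineDouble_barPoint (θ : ℝ) : sineDouble (barPoint θ) = barPoint (2 * θ) := by
  apply Subtype.ext
  simp only [sineDouble, barPoint]
  rw [planeDouble_of_nonpos le_rfl, Real.cos_two_mul]

theorem iterate_sineDouble_barPoint (k : ℕ) (θ : ℝ) :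
    sineDouble^[k] (barPoint θ) = barPoint (2 ^ k * θ) := by
  induction k with
  | zero => simp
  | succ k ih =>
    rw [Function.iterate_succ_apply', ih, sineDouble_barPoint, pow_succ]
    ring_nf

/-- Cosine turns doubling of angles into `t ↦ 2t² - 1`. The angles `2πm / 2^k` reach a multiple of
`2π` after `k` doublings, and as `k` grows they approximate every angle. -/
theorem limitBar_subset_alphaLimit :
    {u : closedSineCurve | u.1.1 = 0} ⊆ alphaLimit sineDouble SineCurve.top := by
  intro u hu
  rw [mem_alphaLimit]
  have hb := (closedSineCurve_subset_box u.2).2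
  set θ := Real.arccos u.1.2 with hθ
  have hu' : barPoint θ = u := by
    apply Subtype.ext
    ext
    · exact hu.symm
    · exact Real.cos_arccos hb.1 hb.2
  have hpi := Real.pi_pos
  let m : ℕ → ℝ := fun k => (⌊2 ^ k * θ / (2 * Real.pi)⌋₊ : ℝ)
  have hθ0 : 0 ≤ θ := Real.arccos_nonneg _
  have hlim : Tendsto (fun k => 2 * Real.pi * (m k / 2 ^ k)) atTop (𝓝 θ) := by
    have h1 : Tendsto (fun k : ℕ => 2 * Real.pi * ((⌊θ / (2 * Real.pi) * (2 : ℝ) ^ k⌋₊ : ℝ) /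
        2 ^ k)) atTop (𝓝 (2 * Real.pi * (θ / (2 * Real.pi)))) :=
      ((tendsto_nat_floor_mul_div_atTop (R := ℝ) (by positivity)).comp
        (tendsto_pow_atTop_atTop_of_one_lt one_lt_two)).const_mul _
    have h2 : 2 * Real.pi * (θ / (2 * Real.pi)) = θ := by field_simp
    rw [h2] at h1
    refine h1.congr fun k => ?_
    simp only [m]
    rw [mul_comm (θ / _), mul_div_assoc]
  intro U hU n
  have h3 := (continuous_barPoint.tendsto θ).comp hlim
  rw [hu'] at h3
  obtain ⟨k, hkU, hk⟩ := ((h3.eventually hU).and (eventually_ge_atTop n)).exists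
  refine ⟨k, hk, _, hkU, ?_⟩
  rw [Function.comp_apply, iterate_sineDouble_barPoint]
  apply Subtype.ext
  simp only [barPoint, SineCurve.top]
  congr 1
  have : 2 ^ k * (2 * Real.pi * (m k / 2 ^ k)) = m k * (2 * Real.pi) := by
    field_simp
  rw [this]
  exact Real.cos_nat_mul_two_pi _

/-- If `f` extends the phase doubling map of an embedded closed sine curve, collapses the closed
set `Q` to the top of its limit bar, and all other points avoid that top point forever, then the
limit bar together with `Q` is an `α`-limit set. -/
theorem isFixedAlphaLimitSet_bar_union {Z : Type*} [TopologicalSpace Z] [T2Space Z]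
    {e : closedSineCurve → Z} (he : Continuous e) (hinj : Function.Injective e)
    {f : Z → Z} (hf : Continuous f) (hfe : ∀ u, f (e u) = e (sineDouble u))
    {Q R : Set Z} (hQ : IsClosed Q) (hQf : ∀ z ∈ Q, f z = e SineCurve.top)
    (hR : ∀ z ∈ R, f z ∈ R) (hRtop : e SineCurve.top ∉ R) (hcover : range e ∪ Q ∪ R = univ) :
    IsFixedAlphaLimitSet (e '' {u | u.1.1 = 0} ∪ Q) := by
  have : CompactSpace closedSineCurve := isCompact_iff_compactSpace.1 isCompact_closedSineCurve
  have htop : f (e SineCurve.top) = e SineCurve.top := by rw [hfe, sineDouble_top]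
  have hbar : IsClosed {u : closedSineCurve | u.1.1 = 0} :=
    isClosed_eq (by fun_prop) continuous_const
  have hcl : IsClosed (e '' {u | u.1.1 = 0} ∪ Q) :=
    (hbar.isCompact.image he).isClosed.union hQ
  have hiter : ∀ k u, f^[k] (e u) = e (sineDouble^[k] u) := fun k u =>
    ((show Function.Semiconj e sineDouble f from fun u => (hfe u).symm).iterate_right k u).symm
  refine ⟨f, hf, e SineCurve.top, htop, Subset.antisymm ?_ ?_⟩
  · intro z hz
    refine hcl.closure_subset (mem_closure_iff_nhds.2 fun U hU => ?_)
    obtain ⟨k, -, u, hu, hk⟩ := mem_alphaLimit.1 hz U hU 0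
    refine ⟨u, hu, ?_⟩
    by_contra hu'
    -- The oscillating part and `R` are both forward invariant and neither contains the top.
    have key : ∀ j, f^[j] u ∈ e '' {u | 0 < u.1.1} ∪ R := by
      intro j
      induction j with
      | zero =>
        have : u ∈ range e ∪ Q ∪ R := hcover ▸ mem_univ _
        rcases this with (⟨v, rfl⟩ | h) | h
        · refine Or.inl ⟨v, lt_of_le_of_ne (fst_nonneg v) fun h => hu' ?_, rfl⟩
          exact Or.inl ⟨v, h.symm, rfl⟩
        · exact absurd (Or.inr h) hu'
        · exact Or.inr h
      | succ j ih =>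
        rw [Function.iterate_succ_apply']
        rcases ih with ⟨v, hv, hv'⟩ | h
        · rw [← hv', hfe]
          exact Or.inl ⟨_, sineDouble_pos hv, rfl⟩
        · exact Or.inr (hR _ h)
    have := key k
    rw [hk] at this
    rcases this with ⟨v, hv, hv'⟩ | h
    · rw [hinj hv'] at hv
      exact lt_irrefl (0 : ℝ) hv
    · exact hRtop h
  · rintro z (⟨u, hu, rfl⟩ | hz)
    · rw [mem_alphaLimit]
      intro U hU n
      obtain ⟨k, hk, v, hv, hkv⟩ := mem_alphaLimit.1 (limitBar_subset_alphaLimit hu) (e ⁻¹' U)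
        (he.continuousAt hU) n
      exact ⟨k, hk, e v, hv, by rw [hiter, hkv]⟩
    · rw [mem_alphaLimit]
      intro U hU n
      refine ⟨n + 1, by omega, z, mem_of_mem_nhds hU, ?_⟩
      rw [Function.iterate_succ_apply, hQf z hz]
      exact Function.iterate_fixed htop n

end Doubling

/-! ### Closed subsets of the extended sine curve -/

section Extended

theorem isFixedAlphaLimitSet_of_closed_or_joined {Z : Type*} [TopologicalSpace Z]
    [MetrizableSpace Z] {B : Set Z} (hB : IsClosed B)
    (h : (∀ u v, u ∈ B → Joined u v → v ∈ B) → IsFixedAlphaLimitSet B) :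
    IsFixedAlphaLimitSet B := by
  by_cases hsat : ∀ u v, u ∈ B → Joined u v → v ∈ B
  · exact h hsat
  · push Not at hsat
    obtain ⟨u, v, hu, huv, hv⟩ := hsat
    exact isFixedAlphaLimitSet_of_joined hB hu hv huv

theorem mem_range_sineInclusion {u : extendedSineCurve} (h : u.1 ∈ closedSineCurve) :
    u ∈ range sineInclusion := ⟨⟨u.1, h⟩, rfl⟩

theorem injective_sineInclusion : Function.Injective sineInclusion :=
  fun _ _ h => Subtype.ext (congrArg (fun w : extendedSineCurve => w.1) h)

theorem bar_joined {u v : extendedSineCurve} (hu : u.1.1 ≤ 0) (hv : v.1.1 ≤ 0) : Joined u v := by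
  have key : ∀ w : extendedSineCurve, w.1.1 ≤ 0 →
      Joined w (sineInclusion SineCurve.bottom) := by
    intro w hw
    rcases extendedSineCurve_cases w.2 with h | h | h
    · exact absurd h.1 (not_lt.2 hw)
    · obtain ⟨w', rfl⟩ := mem_range_sineInclusion (u := w) (by
        have := zero_mem_closedSineCurve h.2.1 h.2.2
        rwa [← h.1] at this)
      exact (joined_of_zero (u := w') h.1 rfl).map continuous_sineInclusion
    · have hF : IsPathConnected (Icc (-1) 0 ×ˢ {-1} : Set (ℝ × ℝ)) :=
        ((convex_Icc _ _).prod (convex_singleton _)).isPathConnected ⟨(0, -1), by simp⟩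
      have hsub : (Icc (-1) 0 ×ˢ {-1} : Set (ℝ × ℝ)) ⊆ extendedSineCurve := by
        rintro ⟨a, t⟩ ⟨h1, h2⟩
        exact Or.inr ⟨h1.1, h1.2, h2⟩
      exact joined_of_joinedIn hsub (hF.joinedIn _ ⟨⟨h.1, h.2.1⟩, h.2.2⟩ _
        (by simp [sineInclusion, SineCurve.bottom]))
  exact (key u hu).trans (key v hv).symm

theorem isFixedAlphaLimitSet_extended (B : Set extendedSineCurve) (hB : IsClosed B)
    (hne : B.Nonempty) : IsFixedAlphaLimitSet B := by
  have : Nonempty extendedSineCurve := ⟨sineInclusion SineCurve.top⟩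
  refine isFixedAlphaLimitSet_of_closed_or_joined hB fun hsat => ?_
  have hbar : (∃ u ∈ B, u.1.1 ≤ 0) → ∀ v : extendedSineCurve, v.1.1 ≤ 0 → v ∈ B := by
    rintro ⟨u, hu, hu0⟩ v hv
    exact hsat u v hu (bar_joined hu0 hv)
  by_cases hpos : ∃ u ∈ B, 0 < u.1.1
  · obtain ⟨u, hu, hu0⟩ := hpos
    have hincl : ∀ v : closedSineCurve, sineInclusion v ∈ B := by
      intro v
      have : closure {u : closedSineCurve | 0 < u.1.1} ⊆ sineInclusion ⁻¹' B := by
        refine closure_minimal ?_ (hB.preimage continuous_sineInclusion)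
        intro w hw
        obtain ⟨u', rfl⟩ := mem_range_sineInclusion (u := u)
          (sineCurve_subset (mem_sineCurve_of_pos_extended u.2 hu0))
        exact hsat _ _ hu ((joined_of_pos (u := u') hu0 hw).map continuous_sineInclusion)
      exact this (dense_pos v)
    have huniv : B = univ := by
      refine eq_univ_of_forall fun v => ?_
      rcases le_or_gt v.1.1 0 with h | h
      · exact hbar ⟨_, hincl SineCurve.top, le_rfl⟩ v h
      · obtain ⟨v', rfl⟩ := mem_range_sineInclusion (u := v)
          (sineCurve_subset (mem_sineCurve_of_pos_extended v.2 h))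
        exact hincl v'
    rw [huniv]
    exact isFixedAlphaLimitSet_univ
  · push Not at hpos
    obtain ⟨u, hu⟩ := hne
    -- Without points of the oscillating part, `B` is the whole arc. The set `Q` is the added
    -- segment, at height `-1`, which doubling sends to the top.
    have hB' : B = sineInclusion '' {u | u.1.1 = 0} ∪
        {u : extendedSineCurve | u.1.1 ≤ 0 ∧ u.1.2 = -1} := by
      ext v
      constructor
      · intro hv
        rcases extendedSineCurve_cases v.2 with h | h | h
        · exact absurd h.1 (not_lt.2 (hpos v hv))
        · obtain ⟨w, rfl⟩ := mem_range_sineInclusion (u := v) (by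
            have := zero_mem_closedSineCurve h.2.1 h.2.2
            rwa [← h.1] at this)
          exact Or.inl ⟨w, h.1, rfl⟩
        · exact Or.inr h.2
      · rintro (⟨w, hw, rfl⟩ | hv)
        · exact hbar ⟨u, hu, hpos u hu⟩ _ (le_of_eq hw)
        · exact hbar ⟨u, hu, hpos u hu⟩ _ hv.1
    rw [hB']
    refine isFixedAlphaLimitSet_bar_union (R := ∅) continuous_sineInclusion
      injective_sineInclusion continuous_extendedDouble (fun u => rfl) ?_ ?_ (by simp) (by simp) ?_
    · have h1 : Continuous fun u : extendedSineCurve => u.1.1 := by fun_prop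
      have h2 : Continuous fun u : extendedSineCurve => u.1.2 := by fun_prop
      exact (isClosed_le h1 continuous_const).inter (isClosed_eq h2 continuous_const)
    · rintro ⟨v, hv'⟩ ⟨h1, h2⟩
      apply Subtype.ext
      simp only at h1 h2
      simp only [extendedDouble, planeDouble_of_nonpos h1, h2]
      norm_num [sineInclusion, SineCurve.top]
    · refine eq_univ_of_forall fun v => Or.inl ?_
      rcases v.2 with h | h
      · exact Or.inl (mem_range_sineInclusion h)
      · exact Or.inr h.2

end Extended

/-! ### Chains: compactness, metrizability and closed subsets -/

/-- The data of a chain of sine curves: copies `e i` of the closed topologist's sine curve, linked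
at the points `e i (d i) = e (i + 1) endpoint`, and converging to `s`. -/
structure SineChain {Y : Type*} [TopologicalSpace Y] (e : ℕ → closedSineCurve → Y)
    (d : ℕ → closedSineCurve) (s : Y) : Prop where
  emb : ∀ i, IsEmbedding (e i)
  notMem : ∀ i u, e i u ≠ s
  cover : ∀ z, z = s ∨ ∃ i u, e i u = z
  small : ∀ U ∈ 𝓝 s, ∃ N, ∀ i, N ≤ i → range (e i) ⊆ U
  disj : ∀ i j, i + 2 ≤ j → Disjoint (range (e i)) (range (e j))
  inter : ∀ i, range (e i) ∩ range (e (i + 1)) = {e i (d i)}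
  top_or_bottom : ∀ i, d i = SineCurve.top ∨ d i = SineCurve.bottom
  link : ∀ i, e i (d i) = e (i + 1) SineCurve.endpoint

theorem IsChainOfSineCurves.exists_sineChain {Y : Type*} [TopologicalSpace Y]
    (h : IsChainOfSineCurves Y) : T2Space Y ∧ ∃ e d, ∃ s : Y, SineChain e d s := by
  obtain ⟨hT2, e, b, s, h1, h2, h3, h4, h5, h6, h7, h8⟩ := h
  have hd : ∀ i, ∃ d, (d = SineCurve.top ∨ d = SineCurve.bottom) ∧ b i = e i d := by
    intro i
    rcases h7 i with h | h
    · exact ⟨_, Or.inl rfl, h⟩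
    · exact ⟨_, Or.inr rfl, h⟩
  choose d hd1 hd2 using hd
  refine ⟨hT2, e, d, s, h1, fun i u h => h2 i ⟨u, h⟩, fun z => ?_, h4, h5, fun i => ?_, hd1,
    fun i => ?_⟩
  · have : z ∈ (⋃ i, range (e i)) ∪ {s} := h3 ▸ mem_univ z
    rcases this with h | h
    · right
      simpa using h
    · exact Or.inl h
  · rw [h6, hd2]
  · rw [← hd2, h8]

namespace SineChain

variable {Y : Type*} [TopologicalSpace Y] {e : ℕ → closedSineCurve → Y}
  {d : ℕ → closedSineCurve} {s : Y}

/-- The union of the first `N` copies. -/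
def head (e : ℕ → closedSineCurve → Y) (N : ℕ) : Set Y := {z | ∃ i < N, ∃ u, e i u = z}

/-- The union of the copies from the `N`-th on and of the limit point. -/
def tail (e : ℕ → closedSineCurve → Y) (s : Y) (N : ℕ) : Set Y :=
  {z | z = s ∨ ∃ i, N ≤ i ∧ ∃ u, e i u = z}

theorem continuous (h : SineChain e d s) (i : ℕ) : Continuous (e i) := (h.emb i).continuous

theorem injective (h : SineChain e d s) (i : ℕ) : Function.Injective (e i) := (h.emb i).injective

theorem compactSpace_closedSineCurve : CompactSpace closedSineCurve :=
  isCompact_iff_compactSpace.1 isCompact_closedSineCurve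

theorem isCompact_range (h : SineChain e d s) (i : ℕ) : IsCompact (range (e i)) :=
  have := compactSpace_closedSineCurve
  _root_.isCompact_range (h.continuous i)

theorem isCompact_head (h : SineChain e d s) (N : ℕ) : IsCompact (head e N) := by
  have : head e N = ⋃ i ∈ Finset.range N, range (e i) := by
    ext z
    simp [head]
  rw [this]
  exact (Finset.range N).isCompact_biUnion fun i _ => h.isCompact_range i

theorem notMem_head (h : SineChain e d s) (N : ℕ) : s ∉ head e N := by
  rintro ⟨i, -, u, hu⟩
  exact h.notMem i u hu

theorem head_or_tail (h : SineChain e d s) (N : ℕ) (z : Y) : z ∈ head e N ∨ z ∈ tail e s N := by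
  rcases h.cover z with hz | ⟨i, u, hu⟩
  · exact Or.inr (Or.inl hz)
  · rcases lt_or_ge i N with hi | hi
    · exact Or.inl ⟨i, hi, u, hu⟩
    · exact Or.inr (Or.inr ⟨i, hi, u, hu⟩)

theorem tail_subset (h : SineChain e d s) {U : Set Y} (hU : U ∈ 𝓝 s) : ∃ N, tail e s N ⊆ U := by
  obtain ⟨N, hN⟩ := h.small U hU
  refine ⟨N, ?_⟩
  rintro z (rfl | ⟨i, hi, u, rfl⟩)
  · exact mem_of_mem_nhds hU
  · exact hN i hi ⟨u, rfl⟩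

/-- An ultrafilter on the tail either contains one of the compact copies, or avoids every finite set
of copies and therefore converges to `s`. -/
theorem isCompact_tail (h : SineChain e d s) (N : ℕ) : IsCompact (tail e s N) := by
  rw [isCompact_iff_ultrafilter_le_nhds]
  intro F hF
  have hF' : tail e s N ∈ F := le_principal_iff.1 hF
  by_cases hR : ∃ i, N ≤ i ∧ range (e i) ∈ F
  · obtain ⟨i, hi, hiF⟩ := hR
    obtain ⟨_, ⟨u, rfl⟩, hz⟩ := isCompact_iff_ultrafilter_le_nhds.1 (h.isCompact_range i) F
      (le_principal_iff.2 hiF)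
    exact ⟨_, Or.inr ⟨i, hi, u, rfl⟩, hz⟩
  · push Not at hR
    refine ⟨s, Or.inl rfl, fun U hU => ?_⟩
    obtain ⟨M, hM⟩ := h.tail_subset hU
    have hfin : (⋂ i ∈ Finset.range M, {z | N ≤ i → z ∉ range (e i)}) ∈ (F : Filter Y) := by
      refine (Filter.biInter_finset_mem _).2 fun i _ => ?_
      by_cases hi : N ≤ i
      · exact mem_of_superset (Ultrafilter.compl_mem_iff_notMem.2 (hR i hi)) fun z hz _ => hz
      · exact mem_of_superset univ_mem fun z _ h => absurd h hi
    refine mem_of_superset (inter_mem hF' hfin) ?_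
    rintro z ⟨rfl | ⟨i, hi, u, rfl⟩, hz⟩
    · exact mem_of_mem_nhds hU
    · refine hM (Or.inr ⟨i, ?_, u, rfl⟩)
      by_contra hlt
      simp only [mem_iInter, Finset.mem_range] at hz
      exact hz i (by omega) hi ⟨u, rfl⟩

theorem tail_zero (h : SineChain e d s) : tail e s 0 = univ :=
  eq_univ_of_forall fun z => (h.cover z).imp id fun ⟨i, u, hu⟩ => ⟨i, Nat.zero_le i, u, hu⟩

theorem compactSpace (h : SineChain e d s) : CompactSpace Y :=
  ⟨h.tail_zero ▸ h.isCompact_tail 0⟩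

theorem eq_of_eq (h : SineChain e d s) {i j : ℕ} (hij : i < j) {u v : closedSineCurve}
    (huv : e i u = e j v) : j = i + 1 ∧ u = d i ∧ v = SineCurve.endpoint := by
  have hj : j = i + 1 := by
    by_contra hne
    exact disjoint_left.1 (h.disj i j (by omega)) ⟨u, rfl⟩ ⟨v, huv.symm⟩
  subst hj
  have : e i u ∈ range (e i) ∩ range (e (i + 1)) := ⟨⟨u, rfl⟩, ⟨v, huv.symm⟩⟩
  rw [h.inter, mem_singleton_iff] at this
  refine ⟨rfl, h.injective i this, h.injective (i + 1) ?_⟩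
  rw [← huv, this, h.link]

theorem eq_endpoint_of_mem_head (h : SineChain e d s) {i : ℕ} {u : closedSineCurve}
    (hu : e i u ∈ head e i) : u = SineCurve.endpoint := by
  obtain ⟨j, hj, v, hv⟩ := hu
  exact (h.eq_of_eq hj hv).2.2

theorem eq_of_mem_tail (h : SineChain e d s) {i : ℕ} {u : closedSineCurve}
    (hu : e i u ∈ tail e s (i + 1)) : u = d i := by
  rcases hu with hu | ⟨j, hj, v, hv⟩
  · exact absurd hu (h.notMem i u)
  · exact (h.eq_of_eq (by omega) hv.symm).2.1

theorem head_inter_tail (h : SineChain e d s) {i : ℕ} {z : Y} (hz : z ∈ head e i)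
    (hz' : z ∈ tail e s i) : z = e i SineCurve.endpoint := by
  obtain ⟨j, hj, u, rfl⟩ := hz
  rcases hz' with hz' | ⟨k, hk, v, hv⟩
  · exact absurd hz' (h.notMem j u)
  · obtain ⟨h1, -, h3⟩ := h.eq_of_eq (by omega) hv.symm
    obtain rfl : k = i := by omega
    rw [← hv, h3]

open Classical in
/-- The retraction of a chain onto its `i`-th copy. -/
noncomputable def retract (e : ℕ → closedSineCurve → Y) (d : ℕ → closedSineCurve) (i : ℕ)
    (z : Y) : closedSineCurve :=
  if z ∈ head e i then SineCurve.endpoint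
  else if hz : ∃ u, e i u = z then hz.choose else d i

theorem retract_of_mem_head {i : ℕ} {z : Y} (hz : z ∈ head e i) :
    retract e d i z = SineCurve.endpoint := if_pos hz

theorem retract_self (h : SineChain e d s) (i : ℕ) (u : closedSineCurve) :
    retract e d i (e i u) = u := by
  by_cases hu : e i u ∈ head e i
  · rw [retract_of_mem_head hu, h.eq_endpoint_of_mem_head hu]
  · have hex : ∃ v, e i v = e i u := ⟨u, rfl⟩
    rw [retract, if_neg hu, dif_pos hex]
    exact h.injective i hex.choose_spec

theorem retract_of_mem_tail (h : SineChain e d s) {i : ℕ} {z : Y} (hz : z ∈ tail e s (i + 1)) :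
    retract e d i z = d i := by
  by_cases hu : ∃ u, e i u = z
  · obtain ⟨u, rfl⟩ := hu
    rw [h.retract_self, h.eq_of_mem_tail hz]
  · have hz' : z ∉ head e i := by
      rintro ⟨j, hj, v, rfl⟩
      rcases hz with hz | ⟨k, hk, w, hw⟩
      · exact h.notMem j v hz
      · have := (h.eq_of_eq (by omega) hw.symm).1
        omega
    rw [retract, if_neg hz', dif_neg hu]

theorem retract_limit (h : SineChain e d s) (i : ℕ) : retract e d i s = d i :=
  h.retract_of_mem_tail (Or.inl rfl)

theorem trichotomy (h : SineChain e d s) (i : ℕ) (z : Y) :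
    z ∈ head e i ∨ z ∈ range (e i) ∨ z ∈ tail e s (i + 1) := by
  rcases h.head_or_tail i z with hz | hz | ⟨j, hj, u, hu⟩
  · exact Or.inl hz
  · exact Or.inr (Or.inr (Or.inl hz))
  · rcases hj.eq_or_lt with rfl | hj
    · exact Or.inr (Or.inl ⟨u, hu⟩)
    · exact Or.inr (Or.inr (Or.inr ⟨j, hj, u, hu⟩))

theorem continuous_of_head_tail [T2Space Y] (h : SineChain e d s) {W : Type*} [TopologicalSpace W]
    (i : ℕ) {f : Y → W} (h1 : ContinuousOn f (head e i)) (h2 : ContinuousOn f (tail e s i)) :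
    Continuous f := by
  rw [← continuousOn_univ]
  have : (univ : Set Y) = head e i ∪ tail e s i :=
    (eq_univ_of_forall fun z => h.head_or_tail i z).symm
  rw [this]
  exact h1.union_of_isClosed h2 (h.isCompact_head i).isClosed (h.isCompact_tail i).isClosed

theorem continuous_retract [T2Space Y] (h : SineChain e d s) (i : ℕ) :
    Continuous (retract e d i) := by
  have := compactSpace_closedSineCurve
  have h1 : ContinuousOn (retract e d i) (head e i) :=
    continuousOn_const.congr fun z hz => retract_of_mem_head hz
  have h2 : ContinuousOn (retract e d i) (tail e s (i + 1)) :=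
    continuousOn_const.congr fun z hz => h.retract_of_mem_tail hz
  have h3 : ContinuousOn (retract e d i) (range (e i)) := by
    rw [continuousOn_iff_isClosed]
    intro F hF
    refine ⟨e i '' F, (hF.isCompact.image (h.continuous i)).isClosed, ?_⟩
    ext z
    constructor
    · rintro ⟨hz, u, rfl⟩
      rw [mem_preimage, h.retract_self] at hz
      exact ⟨⟨u, hz, rfl⟩, u, rfl⟩
    · rintro ⟨⟨u, hu, rfl⟩, hz⟩
      refine ⟨?_, hz⟩
      rwa [mem_preimage, h.retract_self]
  have hr := h.isCompact_range i
  rw [← continuousOn_univ]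
  have huniv : (univ : Set Y) = head e i ∪ (range (e i) ∪ tail e s (i + 1)) :=
    (eq_univ_of_forall fun z => h.trichotomy i z).symm
  rw [huniv]
  exact h1.union_of_isClosed
    (h3.union_of_isClosed h2 hr.isClosed (h.isCompact_tail _).isClosed)
    (h.isCompact_head i).isClosed (hr.isClosed.union (h.isCompact_tail _).isClosed)

theorem d_fst (h : SineChain e d s) (i : ℕ) : (d i).1.1 = 0 := by
  rcases h.top_or_bottom i with hi | hi <;> rw [hi] <;> rfl

theorem endpoint_pos : 0 < SineCurve.endpoint.1.1 := by
  have := Real.pi_pos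
  simp only [SineCurve.endpoint]
  positivity

theorem d_ne_endpoint (h : SineChain e d s) (i : ℕ) : d i ≠ SineCurve.endpoint := by
  intro hi
  have h1 := h.d_fst i
  rw [hi] at h1
  exact endpoint_pos.ne' h1

/-- The retraction onto copy `i` identifies its link point `d i` with everything later; the next
retraction separates that link point, seen as the endpoint, from what lies beyond copy `i + 1`. -/
theorem eq_of_retract (h : SineChain e d s) {i : ℕ} {u : closedSineCurve} {z : Y}
    (hz : z ∈ tail e s i) (heq : ∀ k, retract e d k (e i u) = retract e d k z) : e i u = z := by
  have hi := heq i
  rw [h.retract_self] at hi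
  rcases hz with rfl | ⟨j, hj, v, rfl⟩
  · have := heq (i + 1)
    rw [h.retract_limit, retract_of_mem_head ⟨i, by omega, u, rfl⟩] at this
    exact absurd this.symm (h.d_ne_endpoint _)
  · rcases hj.eq_or_lt with rfl | hj
    · rw [hi, h.retract_self]
    · rw [h.retract_of_mem_tail (Or.inr ⟨j, hj, v, rfl⟩)] at hi
      subst hi
      have h1 := heq (i + 1)
      rw [h.link, h.retract_self] at h1
      rcases Nat.eq_or_lt_of_le (Nat.succ_le_of_lt hj) with hj' | hj'
      · have hj'' : j = i + 1 := hj'.symm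
        subst hj''
        rw [h.retract_self] at h1
        rw [h.link, h1]
      · rw [h.retract_of_mem_tail (Or.inr ⟨j, hj', v, rfl⟩)] at h1
        exact absurd h1.symm (h.d_ne_endpoint _)

/-- The retractions onto all copies jointly embed the compact space `Y` in a countable product of
planar sets. -/
theorem metrizableSpace [T2Space Y] (h : SineChain e d s) : MetrizableSpace Y := by
  have := h.compactSpace
  have hcont : Continuous fun z k => retract e d k z := continuous_pi h.continuous_retract
  refine (hcont.isClosedEmbedding ?_).isEmbedding.metrizableSpace
  intro z w hzw
  have heq : ∀ k, retract e d k z = retract e d k w := fun k => congrFun hzw k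
  rcases h.cover z with rfl | ⟨i, u, rfl⟩
  · rcases h.cover w with rfl | ⟨j, v, rfl⟩
    · rfl
    · exact (h.eq_of_retract (Or.inl rfl) fun k => (heq k).symm).symm
  · rcases h.cover w with rfl | ⟨j, v, rfl⟩
    · exact h.eq_of_retract (Or.inl rfl) heq
    · rcases le_total i j with hij | hij
      · exact h.eq_of_retract (Or.inr ⟨j, hij, v, rfl⟩) heq
      · exact (h.eq_of_retract (Or.inr ⟨i, hij, u, rfl⟩) fun k => (heq k).symm).symm

open Classical in
/-- The self-map of a chain that doubles phases on the `i`-th copy, fixes the earlier copies and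
collapses the later ones. -/
noncomputable def double (e : ℕ → closedSineCurve → Y) (d : ℕ → closedSineCurve) (i : ℕ)
    (z : Y) : Y :=
  if z ∈ head e i then z else e i (sineDouble (retract e d i z))

theorem double_of_mem_head {i : ℕ} {z : Y} (hz : z ∈ head e i) : double e d i z = z := if_pos hz

theorem double_of_mem_tail (h : SineChain e d s) {i : ℕ} {z : Y} (hz : z ∈ tail e s i) :
    double e d i z = e i (sineDouble (retract e d i z)) := by
  by_cases hz' : z ∈ head e i
  · rw [double_of_mem_head hz', retract_of_mem_head hz', sineDouble_endpoint,
      h.head_inter_tail hz' hz]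
  · exact if_neg hz'

theorem continuous_double [T2Space Y] (h : SineChain e d s) (i : ℕ) :
    Continuous (double e d i) := by
  refine h.continuous_of_head_tail i (continuousOn_id.congr fun z hz => double_of_mem_head hz) ?_
  have hc : Continuous fun z => e i (sineDouble (retract e d i z)) :=
    (h.continuous i).comp (continuous_sineDouble.comp (h.continuous_retract i))
  exact hc.continuousOn.congr fun z hz => h.double_of_mem_tail hz

theorem isFixedAlphaLimitSet_bar_union_tail [T2Space Y] (h : SineChain e d s) (i : ℕ) :
    IsFixedAlphaLimitSet (e i '' {u | u.1.1 = 0} ∪ tail e s (i + 1)) := by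
  refine isFixedAlphaLimitSet_bar_union (R := head e i) (h.continuous i) (h.injective i)
    (h.continuous_double i) (fun u => ?_) (h.isCompact_tail _).isClosed (fun z hz => ?_)
    (fun z hz => ?_) (fun hz => ?_) ?_
  · rw [h.double_of_mem_tail (Or.inr ⟨i, le_rfl, u, rfl⟩), h.retract_self]
  · have hz' : z ∈ tail e s i := by
      rcases hz with hz | ⟨j, hj, hu⟩
      · exact Or.inl hz
      · exact Or.inr ⟨j, by omega, hu⟩
    rw [h.double_of_mem_tail hz', h.retract_of_mem_tail hz]
    -- Later copies are collapsed to `d i`; whichever end of the bar this is, doubling sends it to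
    -- the top.
    rcases h.top_or_bottom i with hi | hi <;> rw [hi]
    · rw [sineDouble_top]
    · rw [sineDouble_bottom]
  · rwa [double_of_mem_head hz]
  · exact endpoint_pos.ne (congrArg (fun w : closedSineCurve => w.1.1)
      (h.eq_endpoint_of_mem_head hz))
  · refine eq_univ_of_forall fun z => ?_
    rcases h.trichotomy i z with hz | hz | hz
    · exact Or.inr hz
    · exact Or.inl (Or.inl hz)
    · exact Or.inl (Or.inr hz)

/-- A path-saturated closed set that meets one copy contains its bar, hence the link point and, by
density of the oscillating part, the whole next copy; so it contains all later copies and `s`. Only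
the first copy that it meets remains to be examined. -/
theorem isFixedAlphaLimitSet [T2Space Y] (h : SineChain e d s) (B : Set Y) (hB : IsClosed B)
    (hne : B.Nonempty) : IsFixedAlphaLimitSet B := by
  classical
  have := h.metrizableSpace
  have : Nonempty Y := ⟨s⟩
  refine isFixedAlphaLimitSet_of_closed_or_joined hB fun hsat => ?_
  have hbar : ∀ i u v, e i u ∈ B → u.1.1 = 0 → v.1.1 = 0 → e i v ∈ B := fun i u v hu h1 h2 =>
    hsat _ _ hu ((joined_of_zero h1 h2).map (h.continuous i))
  have hall : ∀ i u, e i u ∈ B → 0 < u.1.1 → ∀ v, e i v ∈ B := by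
    intro i u hu h1 v
    have hsub : closure {u : closedSineCurve | 0 < u.1.1} ⊆ e i ⁻¹' B :=
      closure_minimal (fun w hw => hsat _ _ hu ((joined_of_pos h1 hw).map (h.continuous i)))
        (hB.preimage (h.continuous i))
    exact hsub (dense_pos v)
  have hbarmem : ∀ i u, e i u ∈ B → e i (d i) ∈ B := by
    intro i u hu
    rcases (fst_nonneg u).eq_or_lt with h0 | h0
    · exact hbar i u _ hu h0.symm (h.d_fst i)
    · exact hall i u hu h0 _
  have hnext : ∀ i u, e i u ∈ B → ∀ v, e (i + 1) v ∈ B := by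
    intro i u hu
    have h1 := hbarmem i u hu
    rw [h.link] at h1
    exact hall _ _ h1 endpoint_pos
  by_cases hex : ∃ i u, e i u ∈ B
  · obtain ⟨u, hu⟩ := Nat.find_spec hex
    set i := Nat.find hex with hi
    have hmin : ∀ j < i, ∀ v, e j v ∉ B := fun j hj v hv => Nat.find_min hex hj ⟨v, hv⟩
    have hlater : ∀ j v, e (i + 1 + j) v ∈ B := by
      intro j
      induction j with
      | zero => exact hnext i u hu
      | succ j ih => exact hnext _ _ (ih SineCurve.top)
    have hs : s ∈ B := by
      refine hB.closure_subset (mem_closure_iff_nhds.2 fun U hU => ?_)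
      obtain ⟨N, hN⟩ := h.small U hU
      exact ⟨_, hN (i + 1 + N) (by omega) ⟨SineCurve.top, rfl⟩, hlater N _⟩
    have htail : tail e s (i + 1) ⊆ B := by
      rintro z (rfl | ⟨j, hj, v, rfl⟩)
      · exact hs
      · obtain ⟨k, rfl⟩ := Nat.exists_eq_add_of_le hj
        exact hlater k v
    by_cases hpos : ∃ v, e i v ∈ B ∧ 0 < v.1.1
    · obtain ⟨v, hv, hv0⟩ := hpos
      -- Otherwise the endpoint of copy `i`, which also lies in copy `i - 1`, would be in `B`,
      -- against minimality.
      have hi0 : i = 0 := by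
        by_contra hi0
        obtain ⟨j, hj⟩ : ∃ j, i = j + 1 := ⟨i - 1, by omega⟩
        have := hall i v hv hv0 SineCurve.endpoint
        rw [hj, ← h.link] at this
        exact hmin j (by omega) _ this
      have huniv : B = univ := by
        refine eq_univ_of_forall fun z => ?_
        rcases h.trichotomy i z with ⟨j, hj, -⟩ | ⟨w, rfl⟩ | hz
        · omega
        · exact hall i v hv hv0 w
        · exact htail hz
      rw [huniv]
      exact isFixedAlphaLimitSet_univ
    · push Not at hpos
      have hzero : ∀ v, e i v ∈ B → v.1.1 = 0 := fun v hv =>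
        le_antisymm (hpos v hv) (fst_nonneg v)
      have hB' : B = e i '' {u | u.1.1 = 0} ∪ tail e s (i + 1) := by
        refine Subset.antisymm (fun z hz => ?_) (union_subset ?_ htail)
        · rcases h.trichotomy i z with ⟨j, hj, v, rfl⟩ | ⟨w, rfl⟩ | hz'
          · exact absurd hz (hmin j hj v)
          · exact Or.inl ⟨w, hzero w hz, rfl⟩
          · exact Or.inr hz'
        · rintro _ ⟨v, hv, rfl⟩
          exact hbar i u v hu (hzero u hu) hv
      rw [hB']
      exact h.isFixedAlphaLimitSet_bar_union_tail i
  · push Not at hex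
    have hB' : B = {s} := by
      have hsub : B ⊆ {s} := fun z hz => by
        rcases h.cover z with hz' | ⟨i, u, rfl⟩
        · exact hz'
        · exact absurd hz (hex i u)
      exact (hne.subset_singleton_iff).1 hsub
    rw [hB']
    exact isFixedAlphaLimitSet_singleton s

end SineChain

/-! ### A chain of sine curves in the plane -/

section Planar

/-- The `i`-th copy of a chain of sine curves in the plane that shrinks towards the origin. -/
noncomputable def planarCopy (i : ℕ) (q : ℝ × ℝ) : ℝ × ℝ :=
  ((1 / 2) ^ i * (q.1 + 2 / Real.pi), (1 / 2) ^ i * (q.2 - 1))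

theorem continuous_planarCopy (i : ℕ) : Continuous (planarCopy i) := by
  unfold planarCopy
  fun_prop

theorem injective_planarCopy (i : ℕ) : Function.Injective (planarCopy i) := by
  intro p q h
  have hi : ((1 / 2 : ℝ)) ^ i ≠ 0 := by positivity
  simp only [planarCopy, Prod.mk.injEq, mul_eq_mul_left_iff, hi, or_false] at h
  exact Prod.ext (by linarith [h.1]) (by linarith [h.2])

/-- A chain of sine curves in the plane. -/
def planarChain : Set (ℝ × ℝ) :=
  {q | q = 0 ∨ ∃ i, ∃ u : closedSineCurve, planarCopy i u = q}

/-- The inclusion of the `i`-th copy. -/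
noncomputable def planarEmb (i : ℕ) (u : closedSineCurve) : planarChain :=
  ⟨planarCopy i u, Or.inr ⟨i, u, rfl⟩⟩

/-- Each copy lives over a dyadic interval whose left end is the right end of the next one, so
consecutive copies can only meet over one abscissa and all other pairs are disjoint. -/
theorem planarCopy_fst_mem (i : ℕ) (u : closedSineCurve) :
    (1 / 2) ^ i * (2 / Real.pi) ≤ (planarCopy i u).1 ∧
      (planarCopy i u).1 ≤ 2 * ((1 / 2) ^ i * (2 / Real.pi)) := by
  have hb := (closedSineCurve_subset_box u.2).1
  have hi : (0 : ℝ) < (1 / 2) ^ i := by positivity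
  simp only [planarCopy]
  constructor <;> nlinarith [hb.1, hb.2]

theorem isChainOfSineCurves_planarChain : IsChainOfSineCurves planarChain := by
  have hpi := Real.pi_pos
  have : CompactSpace closedSineCurve := SineChain.compactSpace_closedSineCurve
  have hc : (0 : ℝ) < 2 / Real.pi := by positivity
  refine ⟨inferInstance, planarEmb, fun i => planarEmb i SineCurve.top, ⟨0, Or.inl rfl⟩,
    fun i => ?_, ?_, ?_, ?_, ?_, ?_, fun i => Or.inl rfl, ?_⟩
  · refine (Continuous.isClosedEmbedding ?_ ?_).isEmbedding
    · exact ((continuous_planarCopy i).comp continuous_subtype_val).subtype_mk _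
    · intro u v huv
      exact Subtype.ext (injective_planarCopy i (congrArg Subtype.val huv))
  · rintro i ⟨u, hu⟩
    have h1 := (planarCopy_fst_mem i u).1
    have h2 : planarCopy i u = 0 := congrArg Subtype.val hu
    rw [h2] at h1
    have : (0 : ℝ) < (1 / 2) ^ i * (2 / Real.pi) := by positivity
    exact absurd h1 (not_le.2 this)
  · refine eq_univ_of_forall ?_
    rintro ⟨q, rfl | ⟨i, u, rfl⟩⟩
    · exact Or.inr rfl
    · exact Or.inl (mem_iUnion.2 ⟨i, u, rfl⟩)
  · intro U hU
    obtain ⟨V, hV, hVU⟩ := mem_nhds_subtype _ _ _ |>.1 hU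
    obtain ⟨ε, hε, hball⟩ := Metric.mem_nhds_iff.1 hV
    have hlim : Tendsto (fun i : ℕ => (1 / 2 : ℝ) ^ i * 4) atTop (𝓝 (0 * 4)) :=
      (tendsto_pow_atTop_nhds_zero_of_lt_one (by norm_num) (by norm_num)).mul_const 4
    rw [zero_mul] at hlim
    obtain ⟨N, hN⟩ := eventually_atTop.1 (hlim.eventually_lt_const hε)
    refine ⟨N, fun i hi => ?_⟩
    rintro _ ⟨u, rfl⟩
    refine hVU (hball ?_)
    have hi0 : (0 : ℝ) < (1 / 2) ^ i := by positivity
    have hlt := hN i hi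
    have hb := closedSineCurve_subset_box u.2
    have hpi1 : 2 / Real.pi ≤ 1 := by
      rw [div_le_one hpi]
      linarith [Real.pi_gt_three]
    have h1 := planarCopy_fst_mem i u
    rw [Metric.mem_ball, dist_zero_right, Prod.norm_def, max_lt_iff, Real.norm_eq_abs,
      Real.norm_eq_abs, abs_lt, abs_lt]
    simp only [planarEmb]
    refine ⟨⟨?_, ?_⟩, ?_, ?_⟩
    · nlinarith [h1.1]
    · nlinarith [h1.2]
    · simp only [planarCopy]
      nlinarith [hb.2.1]
    · simp only [planarCopy]
      nlinarith [hb.2.2]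
  · intro i j hij
    rw [disjoint_left]
    rintro _ ⟨u, rfl⟩ ⟨v, hv⟩
    have hv' : planarCopy j v = planarCopy i u := congrArg Subtype.val hv
    have h1 := (planarCopy_fst_mem i u).1
    have h2 := (planarCopy_fst_mem j v).2
    rw [hv'] at h2
    have h3 : (1 / 2 : ℝ) ^ j ≤ (1 / 2) ^ (i + 2) :=
      pow_le_pow_of_le_one (by norm_num) (by norm_num) hij
    have hi0 : (0 : ℝ) < (1 / 2) ^ i := by positivity
    rw [pow_add] at h3
    have h4 : (1 / 2 : ℝ) ^ j * (2 / Real.pi) ≤ (1 / 2) ^ i * (1 / 2) ^ 2 * (2 / Real.pi) :=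
      mul_le_mul_of_nonneg_right h3 hc.le
    have h5 : 0 < (1 / 2 : ℝ) ^ i * (2 / Real.pi) := by positivity
    linarith
  · intro i
    have hi0 : (0 : ℝ) < (1 / 2) ^ i := by positivity
    have hlink : planarEmb i SineCurve.top = planarEmb (i + 1) SineCurve.endpoint := by
      apply Subtype.ext
      simp only [planarEmb, planarCopy, SineCurve.top, SineCurve.endpoint, pow_succ]
      ext
      · simp only
        ring
      · simp
    refine Subset.antisymm ?_ ?_
    · rintro _ ⟨⟨u, rfl⟩, ⟨v, hv⟩⟩
      have hv' : planarCopy (i + 1) v = planarCopy i u := congrArg Subtype.val hv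
      have h1 := congrArg Prod.fst hv'
      simp only [planarCopy, pow_succ] at h1
      have hu := closedSineCurve_subset_box u.2
      have hb := closedSineCurve_subset_box v.2
      have h2 : v.1.1 - 2 / Real.pi = 2 * u.1.1 := by
        have : (1 / 2 : ℝ) ^ i * (v.1.1 - 2 / Real.pi - 2 * u.1.1) = 0 := by linarith
        rcases mul_eq_zero.1 this with h | h
        · exact absurd h hi0.ne'
        · linarith
      have h3 : v.1.1 = 2 / Real.pi := le_antisymm hb.1.2 (by linarith [hu.1.1])
      have h4 : v = SineCurve.endpoint := by
        have h5 := (mem_sineCurve_of_pos v.2 (by rw [h3]; exact hc)).2.2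
        apply Subtype.ext
        ext
        · exact h3
        · rw [h5, h3]
          simp [SineCurve.endpoint]
      change planarEmb i u = planarEmb i SineCurve.top
      rw [hlink, ← h4, ← hv]
    · rintro _ rfl
      exact ⟨⟨_, rfl⟩, ⟨_, hlink.symm⟩⟩
  · intro i
    apply Subtype.ext
    simp only [planarEmb, planarCopy, SineCurve.top, SineCurve.endpoint, pow_succ]
    ext
    · simp only
      ring
    · simp

end Planar

/-! ### Self-maps of the extended sine curve whose `α`-limit set is the arc -/

section Bar

/-- The arc of the extended sine curve consisting of the limit bar and the added segment. -/
def extendedBar : Set extendedSineCurve := {u | u.1.1 ≤ 0}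

theorem mem_extendedBar {u : extendedSineCurve} : u ∈ extendedBar ↔ u.1.1 ≤ 0 := Iff.rfl

theorem not_mem_extendedBar {u : extendedSineCurve} : u ∉ extendedBar ↔ 0 < u.1.1 := by
  rw [mem_extendedBar, not_le]

theorem sineInclusion_top_mem : sineInclusion SineCurve.top ∈ extendedBar :=
  mem_extendedBar.2 (le_refl (0 : ℝ))

theorem isClosed_extendedBar : IsClosed extendedBar := by
  have h1 : Continuous fun u : extendedSineCurve => u.1.1 := by fun_prop
  exact isClosed_le h1 continuous_const

/-- A coordinate on the arc `extendedBar`, extended continuously. -/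
def barCoord (u : extendedSineCurve) : ℝ := u.1.2 + min u.1.1 0

theorem continuous_barCoord : Continuous barCoord := by
  unfold barCoord
  fun_prop

theorem extendedBar_cases {u : extendedSineCurve} (hu : u ∈ extendedBar) :
    (u.1.1 = 0 ∧ -1 ≤ u.1.2 ∧ u.1.2 ≤ 1) ∨ (-1 ≤ u.1.1 ∧ u.1.1 ≤ 0 ∧ u.1.2 = -1) := by
  rcases extendedSineCurve_cases u.2 with h | h
  · exact absurd h.1 (not_lt.2 hu)
  · exact h

theorem barCoord_of_mem {u : extendedSineCurve} (hu : u ∈ extendedBar) :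
    barCoord u = u.1.2 + u.1.1 := by
  rw [barCoord, min_eq_left hu]

theorem barCoord_mem {u : extendedSineCurve} (hu : u ∈ extendedBar) :
    barCoord u ∈ Icc (-2 : ℝ) 1 := by
  rw [barCoord_of_mem hu]
  rcases extendedBar_cases hu with h | h
  · exact ⟨by linarith [h.1, h.2.1], by linarith [h.1, h.2.2]⟩
  · exact ⟨by linarith [h.1, h.2.2], by linarith [h.2.1, h.2.2]⟩

theorem injOn_barCoord : InjOn barCoord extendedBar := by
  intro u hu v hv huv
  rw [barCoord_of_mem hu, barCoord_of_mem hv] at huv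
  apply Subtype.ext
  rcases extendedBar_cases hu with h | h <;> rcases extendedBar_cases hv with h' | h'
  · exact Prod.ext (by linarith [h.1, h'.1]) (by linarith [h.1, h'.1])
  · exact Prod.ext (by linarith [h.1, h.2.1, h'.2.1, h'.2.2])
      (by linarith [h.1, h.2.1, h'.2.1, h'.2.2])
  · exact Prod.ext (by linarith [h'.1, h'.2.1, h.2.1, h.2.2])
      (by linarith [h'.1, h'.2.1, h.2.1, h.2.2])
  · exact Prod.ext (by linarith [h.2.2, h'.2.2]) (by linarith [h.2.2, h'.2.2])

/-- The parametrization of the arc `extendedBar` inverse to `barCoord`. -/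
noncomputable def barParam (t : ℝ) : extendedSineCurve :=
  ⟨(min (max (-2) (min t 1) + 1) 0, max (max (-2) (min t 1)) (-1)), by
    have h1 : (-2 : ℝ) ≤ max (-2) (min t 1) := le_max_left _ _
    have h2 : max (-2) (min t 1) ≤ 1 := max_le (by norm_num) (min_le_right _ _)
    generalize max (-2) (min t 1) = r at h1 h2
    rcases le_total r (-1) with h | h
    · rw [min_eq_left (by linarith), max_eq_right h]
      exact Or.inr ⟨by simp only; linarith, by simp only; linarith, rfl⟩
    · rw [min_eq_right (by linarith), max_eq_left h]
      exact Or.inl (zero_mem_closedSineCurve h h2)⟩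

theorem continuous_barParam : Continuous barParam :=
  Continuous.subtype_mk (by fun_prop) _

theorem barParam_mem (t : ℝ) : barParam t ∈ extendedBar :=
  mem_extendedBar.2 (min_le_right _ _)

theorem barCoord_barParam {t : ℝ} (ht : t ∈ Icc (-2 : ℝ) 1) : barCoord (barParam t) = t := by
  rw [barCoord_of_mem (barParam_mem t)]
  simp only [barParam, min_eq_left ht.2, max_eq_right ht.1]
  rcases le_total t (-1) with h | h
  · rw [min_eq_left (by linarith), max_eq_right h]
    ring
  · rw [min_eq_right (by linarith), max_eq_left h]
    ring

theorem barParam_barCoord {u : extendedSineCurve} (hu : u ∈ extendedBar) :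
    barParam (barCoord u) = u :=
  injOn_barCoord (barParam_mem _) hu (barCoord_barParam (barCoord_mem hu))

theorem isPathConnected_pos : IsPathConnected {u : extendedSineCurve | 0 < u.1.1} := by
  rw [IsInducing.subtypeVal.isPathConnected_iff]
  convert isPathConnected_sineCurve using 1
  ext q
  constructor
  · rintro ⟨u, hu, rfl⟩
    exact mem_sineCurve_of_pos_extended u.2 hu
  · intro hq
    exact ⟨⟨q, closedSineCurve_subset_extended (sineCurve_subset hq)⟩, hq.1, rfl⟩

theorem mem_of_joined {u v : extendedSineCurve} (h : Joined u v) (hu : u ∈ extendedBar) :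
    v ∈ extendedBar :=
  fst_nonpos_of_path h hu

variable {g : extendedSineCurve → extendedSineCurve} {x : extendedSineCurve}

/-- A path from `u₁` to `u₂` off the arc is compact, so late preimages of `x` miss it. Its image
covers the subarc between `g u₁` and `g u₂`, and a `k`-th preimage there would pull back to a `(k +
1)`-st preimage on the path. -/
theorem exists_forall_barCoord_notMem_uIcc (hg : Continuous g)
    (hα : alphaLimit g x = extendedBar) (hpos : ∀ u, u ∉ extendedBar → g u ∈ extendedBar)
    {u₁ u₂ : extendedSineCurve} (h₁ : u₁ ∉ extendedBar) (h₂ : u₂ ∉ extendedBar) :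
    ∃ n, ∀ k, n ≤ k → ∀ v ∈ extendedBar, g^[k] v = x →
      barCoord v ∉ uIcc (barCoord (g u₁)) (barCoord (g u₂)) := by
  obtain ⟨γ, hγ⟩ := isPathConnected_pos.joinedIn u₁ (not_mem_extendedBar.1 h₁) u₂
    (not_mem_extendedBar.1 h₂)
  have hK : IsCompact (range γ) := isCompact_range γ.continuous
  have hbar : ∀ t, γ t ∉ extendedBar := fun t => not_mem_extendedBar.2 (hγ t)
  have hdisj : Disjoint (range γ) (accSet fun k => g^[k] ⁻¹' {x}) := by
    rw [← alphaLimit_eq_accSet, hα, disjoint_left]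
    rintro _ ⟨t, rfl⟩
    exact hbar t
  obtain ⟨n, hn⟩ := hK.eventually_disjoint_of_accSet hdisj
  refine ⟨n, fun k hk v hv hvx hmem => ?_⟩
  have hc : Continuous fun t => barCoord (g (γ t)) :=
    continuous_barCoord.comp (hg.comp γ.continuous)
  have hIVT : barCoord v ∈ range fun t => barCoord (g (γ t)) := by
    have hoc : OrdConnected (range fun t => barCoord (g (γ t))) :=
      (isPreconnected_range hc).ordConnected
    exact hoc.uIcc_subset ⟨0, by simp⟩ ⟨1, by simp⟩ hmem
  obtain ⟨t, ht⟩ := hIVT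
  have heq : g (γ t) = v := injOn_barCoord (hpos _ (hbar t)) hv ht
  refine disjoint_left.1 (hn (k + 1) (by omega)) ⟨t, rfl⟩ ?_
  rw [mem_preimage, Function.iterate_succ_apply, heq]
  exact hvx

/-- If `g` were not constant off the arc, its values there would span an open interval `I` of the
arc that is locally free of late preimages lying in the arc. Points over `I` are still in the
`α`-limit set, so they are approached by preimages off the arc. This forces `g` to be constant over
`I`, and the constancy then produces a late preimage over `I`. -/
theorem eqOn_pos_of_mapsTo_bar (hg : Continuous g)
    (hα : alphaLimit g x = extendedBar) (hpos : ∀ u, u ∉ extendedBar → g u ∈ extendedBar)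
    {a b : extendedSineCurve} (ha : a ∉ extendedBar) (hb : b ∉ extendedBar) : g a = g b := by
  set J : Set ℝ := (fun u => barCoord (g u)) '' {u | u ∉ extendedBar} with hJ
  set I : Set ℝ := {t | ∃ t₁ ∈ J, ∃ t₂ ∈ J, t₁ < t ∧ t < t₂} with hI
  have hbar : ∀ v ∈ extendedBar, g v ∈ extendedBar := fun v hv => by
    have h : MapsTo g (alphaLimit g x) (alphaLimit g x) := mapsTo_alphaLimit hg
    rw [hα] at h
    exact h hv
  have hacc : ∀ v ∈ extendedBar, ∀ U ∈ 𝓝 v, ∀ n, ∃ k, n ≤ k ∧ ∃ u ∈ U, g^[k] u = x := by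
    intro v hv
    rw [← hα] at hv
    exact mem_alphaLimit.1 hv
  have hcG : Continuous fun u => barCoord (g u) := continuous_barCoord.comp hg
  have hfree : ∀ t ∈ I, ∃ t₁ t₂, t₁ < t ∧ t < t₂ ∧ ∃ n, ∀ k, n ≤ k → ∀ v ∈ extendedBar,
      g^[k] v = x → barCoord v ∉ Ioo t₁ t₂ := by
    rintro t ⟨_, ⟨u₁, h₁, rfl⟩, _, ⟨u₂, h₂, rfl⟩, hlt1, hlt2⟩
    obtain ⟨n, hn⟩ := exists_forall_barCoord_notMem_uIcc hg hα hpos h₁ h₂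
    refine ⟨_, _, hlt1, hlt2, n, fun k hk v hv hvx hmem => hn k hk v hv hvx ?_⟩
    exact Icc_subset_uIcc (Ioo_subset_Icc_self hmem)
  have hpt : ∀ t ∈ J, ∃ n, ∀ k, n ≤ k → ∀ v ∈ extendedBar, g^[k] v = x → barCoord v ≠ t := by
    rintro _ ⟨u, hu, rfl⟩
    obtain ⟨n, hn⟩ := exists_forall_barCoord_notMem_uIcc hg hα hpos hu hu
    refine ⟨n, fun k hk v hv hvx heq => hn k hk v hv hvx ?_⟩
    rw [heq]
    exact left_mem_uIcc
  -- Late preimages `u` near `v` are off the arc, so `g u` has coordinate in `J`; it is itself a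
  -- preimage of order one less, so `g v` cannot lie over the free set `I`.
  have hII : ∀ v ∈ extendedBar, barCoord v ∈ I →
      barCoord (g v) ∉ I ∧ barCoord (g v) ∈ closure J := by
    intro v hv hvI
    obtain ⟨s₁, s₂, hs₁, hs₂, n₂, hn₂⟩ := hfree _ hvI
    have hUs : barCoord ⁻¹' Ioo s₁ s₂ ∈ 𝓝 v :=
      continuous_barCoord.continuousAt (Ioo_mem_nhds hs₁ hs₂)
    constructor
    · intro hgI
      obtain ⟨t₁, t₂, ht₁, ht₂, n₁, hn₁⟩ := hfree _ hgI
      obtain ⟨k, hk, u, ⟨hu1, hu2⟩, hux⟩ := hacc v hv _ (inter_mem hUs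
        (hcG.continuousAt (Ioo_mem_nhds ht₁ ht₂))) (max n₁ n₂ + 1)
      have hu : u ∉ extendedBar := fun hu =>
        hn₂ k (by have := le_max_right n₁ n₂; omega) u hu hux hu1
      obtain ⟨m, rfl⟩ : ∃ m, k = m + 1 := ⟨k - 1, by omega⟩
      exact hn₁ m (by have := le_max_left n₁ n₂; omega) (g u) (hpos u hu) hux hu2
    · rw [mem_closure_iff_nhds]
      intro O hO
      obtain ⟨k, hk, u, ⟨hu1, hu2⟩, hux⟩ := hacc v hv _ (inter_mem hUs
        (hcG.continuousAt hO)) n₂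
      have hu : u ∉ extendedBar := fun hu => hn₂ k hk u hu hux hu1
      exact ⟨_, hu2, u, hu, rfl⟩
  have hIbar : ∀ t ∈ I, t ∈ Icc (-2 : ℝ) 1 := by
    rintro t ⟨_, ⟨u₁, h₁, rfl⟩, _, ⟨u₂, h₂, rfl⟩, hlt1, hlt2⟩
    exact ⟨(barCoord_mem (hpos _ h₁)).1.trans hlt1.le,
      hlt2.le.trans (barCoord_mem (hpos _ h₂)).2⟩
  have hIconn : IsPreconnected I := by
    refine OrdConnected.isPreconnected ⟨?_⟩
    rintro t ⟨t₁, ht₁, -, -, h1, -⟩ t' ⟨-, -, t₂, ht₂, -, h2⟩ r hr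
    exact ⟨t₁, ht₁, t₂, ht₂, h1.trans_le hr.1, hr.2.trans_lt h2⟩
  -- Two different values over `I` would both lie in the closure of `J`, and the intermediate value
  -- halfway between them would be in `I`.
  have hnlt : ∀ v ∈ extendedBar, ∀ v' ∈ extendedBar, barCoord v ∈ I → barCoord v' ∈ I →
      ¬ barCoord (g v) < barCoord (g v') := by
    intro v hv v' hv' hvI hvI' hlt
    have hc : Continuous fun t => barCoord (g (barParam t)) := hcG.comp continuous_barParam
    obtain ⟨t, htI, ht⟩ := hIconn.intermediate_value hvI hvI' hc.continuousOn
      (show (barCoord (g v) + barCoord (g v')) / 2 ∈ _ by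
        simp only [barParam_barCoord hv, barParam_barCoord hv']
        exact ⟨by linarith, by linarith⟩)
    simp only at ht
    have hpI : barCoord (barParam t) ∈ I := by rwa [barCoord_barParam (hIbar t htI)]
    refine (hII _ (barParam_mem t) hpI).1 ?_
    rw [ht]
    obtain ⟨t₁, ht₁, h₁⟩ := mem_closure_iff_nhds.1 (hII v hv hvI).2
      (Iio ((barCoord (g v) + barCoord (g v')) / 2)) (Iio_mem_nhds (by linarith))
    obtain ⟨t₂, ht₂, h₂⟩ := mem_closure_iff_nhds.1 (hII v' hv' hvI').2
      (Ioi ((barCoord (g v) + barCoord (g v')) / 2)) (Ioi_mem_nhds (by linarith))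
    exact ⟨t₁, h₁, t₂, h₂, ht₁, ht₂⟩
  have hconst : ∀ v ∈ extendedBar, ∀ v' ∈ extendedBar, barCoord v ∈ I → barCoord v' ∈ I →
      g v = g v' := fun v hv v' hv' hvI hvI' =>
    injOn_barCoord (hbar v hv) (hbar v' hv')
      (le_antisymm (not_lt.1 (hnlt v' hv' v hv hvI' hvI)) (not_lt.1 (hnlt v hv v' hv' hvI hvI')))
  by_contra hne
  obtain ⟨t₁, ht₁, t₂, ht₂, hlt⟩ : ∃ t₁ ∈ J, ∃ t₂ ∈ J, t₁ < t₂ := by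
    have hne' : barCoord (g a) ≠ barCoord (g b) := fun h =>
      hne (injOn_barCoord (hpos a ha) (hpos b hb) h)
    rcases lt_or_gt_of_ne hne' with h | h
    · exact ⟨_, ⟨a, ha, rfl⟩, _, ⟨b, hb, rfl⟩, h⟩
    · exact ⟨_, ⟨b, hb, rfl⟩, _, ⟨a, ha, rfl⟩, h⟩
  have hmid : (t₁ + t₂) / 2 ∈ I := ⟨t₁, ht₁, t₂, ht₂, by linarith, by linarith⟩
  set v₀ := barParam ((t₁ + t₂) / 2) with hv₀
  have hv₀bar : v₀ ∈ extendedBar := barParam_mem _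
  have hv₀I : barCoord v₀ ∈ I := by rwa [hv₀, barCoord_barParam (hIbar _ hmid)]
  obtain ⟨s₁, s₂, hs₁, hs₂, n₁, hn₁⟩ := hfree _ hv₀I
  -- `J` may contain its extreme points, which are not in `I`; each is a single value of `J` and so
  -- is eventually avoided.
  obtain ⟨n₂, hn₂⟩ : ∃ n, ∀ k, n ≤ k → ∀ v ∈ extendedBar, g^[k] v = x →
      ¬ IsLeast J (barCoord v) := by
    by_cases h : ∃ z, IsLeast J z
    · obtain ⟨z, hz⟩ := h
      obtain ⟨n, hn⟩ := hpt z hz.1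
      exact ⟨n, fun k hk v hv hvx hl => hn k hk v hv hvx (hl.unique hz)⟩
    · exact ⟨0, fun k _ v _ _ hl => h ⟨_, hl⟩⟩
  obtain ⟨n₃, hn₃⟩ : ∃ n, ∀ k, n ≤ k → ∀ v ∈ extendedBar, g^[k] v = x →
      ¬ IsGreatest J (barCoord v) := by
    by_cases h : ∃ z, IsGreatest J z
    · obtain ⟨z, hz⟩ := h
      obtain ⟨n, hn⟩ := hpt z hz.1
      exact ⟨n, fun k hk v hv hvx hl => hn k hk v hv hvx (hl.unique hz)⟩
    · exact ⟨0, fun k _ v _ _ hl => h ⟨_, hl⟩⟩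
  obtain ⟨k, hk, u, hu, hux⟩ := hacc v₀ hv₀bar _
    (continuous_barCoord.continuousAt (Ioo_mem_nhds hs₁ hs₂)) (n₁ + n₂ + n₃ + 2)
  have hubar : u ∉ extendedBar := fun hub => hn₁ k (by omega) u hub hux hu
  obtain ⟨m, rfl⟩ : ∃ m, k = m + 2 := ⟨k - 2, by omega⟩
  rw [Function.iterate_succ_apply] at hux
  have hd := hpos u hubar
  have hdJ : barCoord (g u) ∈ J := ⟨u, hubar, rfl⟩
  have hdI : barCoord (g u) ∈ I := by
    have h1 := hn₂ (m + 1) (by omega) (g u) hd hux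
    have h2 := hn₃ (m + 1) (by omega) (g u) hd hux
    simp only [IsLeast, IsGreatest, hdJ, true_and, lowerBounds, upperBounds, mem_ofPred_eq,
      not_forall, not_le] at h1 h2
    obtain ⟨r₁, hr₁, h1⟩ := h1
    obtain ⟨r₂, hr₂, h2⟩ := h2
    exact ⟨r₁, hr₁, r₂, hr₂, h1, h2⟩
  -- Both `g u` and `v₀` lie over `I`, so `g u` can be replaced by `v₀`, which becomes a late
  -- preimage in the free interval.
  rw [Function.iterate_succ_apply, hconst _ hd _ hv₀bar hdI hv₀I,
    ← Function.iterate_succ_apply] at hux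
  exact hn₁ (m + 1) (by omega) v₀ hv₀bar hux ⟨hs₁, hs₂⟩

theorem sineInclusion_endpoint_notMem : sineInclusion SineCurve.endpoint ∉ extendedBar :=
  not_mem_extendedBar.2 SineChain.endpoint_pos

/-- Either the oscillating part is invariant and never reaches `x`, or it all goes into the arc. In
the latter case `g` is constant on it, so one late preimage there would make the fixed point of
reference `u₀` a late preimage too, although `u₀` is not in the `α`-limit set. -/
theorem exists_preimage_subset_extendedBar (hg : Continuous g)
    (hα : alphaLimit g x = extendedBar) (hx : x ∈ extendedBar) :
    ∃ n, ∀ k, n ≤ k → ∀ u, g^[k] u = x → u ∈ extendedBar := by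
  by_cases hpp : ∀ u, u ∉ extendedBar → g u ∉ extendedBar
  · refine ⟨0, fun k _ u hux => ?_⟩
    by_contra hu
    have key : ∀ j, g^[j] u ∉ extendedBar := by
      intro j
      induction j with
      | zero => exact hu
      | succ j ih => rw [Function.iterate_succ_apply']; exact hpp _ ih
    exact key k (hux ▸ hx)
  · push Not at hpp
    obtain ⟨u₀, hu₀, hgu₀⟩ := hpp
    have hpos : ∀ u, u ∉ extendedBar → g u ∈ extendedBar := fun u hu =>
      mem_of_joined ((isPathConnected_pos.joinedIn u₀ (not_mem_extendedBar.1 hu₀) u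
        (not_mem_extendedBar.1 hu)).joined.map hg) hgu₀
    obtain ⟨n, hn⟩ := (isCompact_singleton (x := u₀)).eventually_disjoint_of_accSet
      (E := fun k => g^[k] ⁻¹' {x}) (by
        rw [← alphaLimit_eq_accSet, hα]
        exact disjoint_singleton_left.2 hu₀)
    refine ⟨n + 1, fun k hk u hux => ?_⟩
    by_contra hu
    obtain ⟨m, rfl⟩ : ∃ m, k = m + 1 := ⟨k - 1, by omega⟩
    refine disjoint_singleton_left.1 (hn (m + 1) (by omega)) ?_
    rw [mem_preimage, Function.iterate_succ_apply, eqOn_pos_of_mapsTo_bar hg hα hpos hu₀ hu,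
      ← Function.iterate_succ_apply, hux]
    rfl

theorem preconnectedSpace_closedSineCurve : PreconnectedSpace closedSineCurve :=
  Subtype.preconnectedSpace isPathConnected_sineCurve.isConnected.isPreconnected.closure

theorem preconnectedSpace_extendedSineCurve : PreconnectedSpace extendedSineCurve := by
  refine Subtype.preconnectedSpace ?_
  refine IsPreconnected.union (0, -1) bottom_mem_closedSineCurve (by simp)
    isPathConnected_sineCurve.isConnected.isPreconnected.closure ?_
  have : {q : ℝ × ℝ | -1 ≤ q.1 ∧ q.1 ≤ 0 ∧ q.2 = -1} = Icc (-1 : ℝ) 0 ×ˢ {(-1 : ℝ)} := by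
    ext q
    simp [and_assoc]
  rw [this]
  exact isPreconnected_Icc.prod isPreconnected_singleton

end Bar

/-! ### Maps between a chain and the extended sine curve -/

namespace SineChain

variable {Y : Type*} [TopologicalSpace Y] {e : ℕ → closedSineCurve → Y}
  {d : ℕ → closedSineCurve} {s : Y}

/-- The union of the copies with indices between `N` and `N + M`. -/
def segment (e : ℕ → closedSineCurve → Y) (N M : ℕ) : Set Y :=
  ⋃ i ∈ Finset.range (M + 1), range (e (N + i))

theorem isCompact_segment (h : SineChain e d s) (N M : ℕ) : IsCompact (segment e N M) :=
  Finset.isCompact_biUnion _ fun _ _ => h.isCompact_range _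

theorem mem_segment {N M i : ℕ} (hi : i ≤ M) (u : closedSineCurve) :
    e (N + i) u ∈ segment e N M := by
  simp only [segment, mem_iUnion, Finset.mem_range]
  exact ⟨i, by omega, u, rfl⟩

theorem notMem_segment (h : SineChain e d s) (N M : ℕ) : s ∉ segment e N M := by
  simp only [segment, mem_iUnion]
  rintro ⟨i, -, u, hu⟩
  exact h.notMem _ u hu

theorem isPreconnected_segment (h : SineChain e d s) (N M : ℕ) :
    IsPreconnected (segment e N M) := by
  have := preconnectedSpace_closedSineCurve
  induction M with
  | zero =>
    simp only [segment, zero_add, Finset.range_one, Finset.mem_singleton, iUnion_iUnion_eq_left]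
    exact isPreconnected_range (h.continuous _)
  | succ M ih =>
    have hsucc : segment e N (M + 1) = segment e N M ∪ range (e (N + (M + 1))) := by
      rw [segment, Finset.range_add_one, Finset.set_biUnion_insert, union_comm]
      rfl
    rw [hsucc]
    refine IsPreconnected.union (e (N + M) (d (N + M))) (mem_segment le_rfl _) ?_ ih
      (isPreconnected_range (h.continuous _))
    rw [h.link]
    exact ⟨_, rfl⟩

theorem tail_subset_closure (h : SineChain e d s) (N : ℕ) :
    tail e s N ⊆ closure (⋃ M, segment e N M) := by
  have hmem : ∀ i, N ≤ i → ∀ u, e i u ∈ ⋃ M, segment e N M := by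
    intro i hi u
    obtain ⟨k, rfl⟩ := Nat.exists_eq_add_of_le hi
    exact mem_iUnion.2 ⟨k, mem_segment le_rfl u⟩
  rintro z (rfl | ⟨i, hi, u, rfl⟩)
  · rw [mem_closure_iff_nhds]
    intro U hU
    obtain ⟨K, hK⟩ := h.small U hU
    exact ⟨_, hK (N + K) (by omega) ⟨SineCurve.top, rfl⟩, hmem _ (by omega) _⟩
  · exact subset_closure (hmem i hi u)

theorem segment_subset_tail (N M : ℕ) : segment e N M ⊆ tail e s N := by
  simp only [segment, iUnion_subset_iff]
  rintro _ - _ ⟨u, rfl⟩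
  exact Or.inr ⟨_, by omega, u, rfl⟩

theorem isPreconnected_tail (h : SineChain e d s) (N : ℕ) : IsPreconnected (tail e s N) := by
  refine IsPreconnected.subset_closure ?_ (iUnion_subset fun M => segment_subset_tail N M)
    (h.tail_subset_closure N)
  exact isPreconnected_iUnion ⟨e (N + 0) SineCurve.top,
    mem_iInter.2 fun M => mem_segment (Nat.zero_le M) _⟩ fun M => h.isPreconnected_segment N M

theorem preconnectedSpace (h : SineChain e d s) : PreconnectedSpace Y :=
  ⟨h.tail_zero ▸ h.isPreconnected_tail 0⟩

theorem tail_mem_nhds [T2Space Y] (h : SineChain e d s) (N : ℕ) : tail e s N ∈ 𝓝 s := by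
  refine mem_of_superset ((h.isCompact_head N).isClosed.isOpen_compl.mem_nhds (h.notMem_head N)) ?_
  exact fun z hz => (h.head_or_tail N z).resolve_left hz

/-- The oscillating part is path connected, and no path in `Y` crosses a whole copy from its
endpoint to its bar. Hence, if one value differs from `s`, the values off the arc stay in a compact
union of finitely many copies, and `s` cannot be their limit. -/
theorem eq_limit_of_map_extendedBar [T2Space Y] (h : SineChain e d s) {φ : extendedSineCurve → Y}
    (hφ : Continuous φ) (hbar : ∀ u ∈ extendedBar, φ u = s) (u : extendedSineCurve) :
    φ u = s := by
  by_contra hu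
  have hubar : u ∉ extendedBar := fun h' => hu (hbar u h')
  obtain ⟨j, q, hq⟩ := (h.cover (φ u)).resolve_left hu
  have hhead : ∀ v, v ∉ extendedBar → φ v ∈ head e (j + 2) := by
    intro v hv
    by_contra hv'
    have hvt := (h.head_or_tail (j + 2) (φ v)).resolve_left hv'
    have hjoin : Joined v u := (isPathConnected_pos.joinedIn v (not_mem_extendedBar.1 hv) u
      (not_mem_extendedBar.1 hubar)).joined
    -- Copy `j + 1` separates `φ u` from `φ v`: its retraction sends the former to the endpoint and
    -- the latter to the bar.
    have hjoin' := hjoin.map ((h.continuous_retract (j + 1)).comp hφ)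
    simp only [Function.comp_apply] at hjoin'
    rw [h.retract_of_mem_tail hvt, retract_of_mem_head ⟨j, by omega, q, hq⟩] at hjoin'
    exact endpoint_pos.ne' (fst_eq_zero_of_joined hjoin' (h.d_fst _))
  have htop : sineInclusion SineCurve.top ∈ closure {v : extendedSineCurve | v ∉ extendedBar} := by
    have h1 := image_closure_subset_closure_image continuous_sineInclusion
      (mem_image_of_mem sineInclusion (dense_pos SineCurve.top))
    refine closure_mono ?_ h1
    rintro _ ⟨w, hw, rfl⟩
    exact not_mem_extendedBar.2 hw
  have hcl : closure {v : extendedSineCurve | v ∉ extendedBar} ⊆ φ ⁻¹' head e (j + 2) :=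
    closure_minimal hhead ((h.isCompact_head _).isClosed.preimage hφ)
  have := hcl htop
  rw [mem_preimage, hbar _ sineInclusion_top_mem] at this
  exact h.notMem_head _ this

theorem false_of_accSet_eq_limit [T2Space Y] (h : SineChain e d s)
    {g : extendedSineCurve → extendedSineCurve} (hg : Continuous g) {x : extendedSineCurve}
    (hα : alphaLimit g x = extendedBar) {φ : Y → extendedSineCurve} (hφ : Continuous φ)
    (hs : φ s ∈ extendedBar) (hacc : accSet (fun k => φ ⁻¹' (g^[k] ⁻¹' {x})) = {s}) : False := by
  have hU : {z | |(φ z).1.2 - (φ s).1.2| < 1 / 2} ∈ 𝓝 s := by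
    refine IsOpen.mem_nhds (isOpen_lt (by fun_prop) continuous_const) (by simp)
  obtain ⟨N, hN⟩ := h.tail_subset hU
  -- The tail is connected and its image has small height variation, so it cannot enter the
  -- oscillating part.
  have htail : ∀ z ∈ tail e s N, φ z ∈ extendedBar :=
    fst_nonpos_of_isPreconnected (h.isPreconnected_tail N)
      (continuous_subtype_val.comp hφ) (fun z _ => (φ z).2) (Or.inl rfl) hs fun z hz => hN hz
  have hoften : ∀ n, ∃ k, n ≤ k ∧ ∃ z ∈ tail e s N, g^[k] (φ z) = x :=
    mem_accSet.1 (hacc ▸ mem_singleton s : s ∈ accSet _) _ (h.tail_mem_nhds N)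
  have hrare : ∀ K : Set Y, IsCompact K → s ∉ K → ∃ n, ∀ k, n ≤ k → ∀ z ∈ K, g^[k] (φ z) ≠ x := by
    intro K hK hsK
    obtain ⟨n, hn⟩ := hK.eventually_disjoint_of_accSet
      (E := fun k => φ ⁻¹' (g^[k] ⁻¹' {x})) (by
        rw [hacc]
        exact disjoint_singleton_right.2 hsK)
    exact ⟨n, fun k hk z hz hx => disjoint_left.1 (hn k hk) hz hx⟩
  have hbar : MapsTo g extendedBar extendedBar := hα ▸ mapsTo_alphaLimit hg
  have hx : x ∈ extendedBar := by
    obtain ⟨k, -, z, hz, hk⟩ := hoften 0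
    exact hk ▸ hbar.iterate k (htail z hz)
  obtain ⟨n₀, hn₀⟩ := exists_preimage_subset_extendedBar hg hα hx
  -- If `φ` takes two values on a finite stretch, the stretch covers the subarc between them, where
  -- late preimages are found; they lift to the stretch, a compact set without `s`.
  have hnlt : ∀ M, ∀ y ∈ segment e N M, ∀ z ∈ segment e N M,
      ¬ barCoord (φ y) < barCoord (φ z) := by
    intro M y hy z hz hlt
    have hc : Continuous fun y => barCoord (φ y) := continuous_barCoord.comp hφ
    have hIVT := (h.isPreconnected_segment N M).intermediate_value hy hz hc.continuousOn
    obtain ⟨w, hw, hwm⟩ := hIVT (show (barCoord (φ y) + barCoord (φ z)) / 2 ∈ _ from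
      ⟨by linarith, by linarith⟩)
    simp only at hwm
    have hwα : φ w ∈ alphaLimit g x := hα ▸ htail w (segment_subset_tail N M hw)
    obtain ⟨n, hn⟩ := hrare _ (h.isCompact_segment N M) (h.notMem_segment N M)
    obtain ⟨k, hk, u, hu, hux⟩ := mem_alphaLimit.1 hwα
      (barCoord ⁻¹' Ioo (barCoord (φ y)) (barCoord (φ z)))
      (continuous_barCoord.continuousAt (Ioo_mem_nhds (by linarith) (by linarith))) (n + n₀)
    obtain ⟨y', hy', hyu⟩ := hIVT ⟨hu.1.le, hu.2.le⟩
    have huy : φ y' = u := injOn_barCoord (htail _ (segment_subset_tail N M hy'))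
      (hn₀ k (by omega) u hux) hyu
    exact hn k (by omega) y' hy' (huy ▸ hux)
  have hconst : ∀ z ∈ tail e s N, φ z = φ (e N SineCurve.top) := by
    have hsub : closure (⋃ M, segment e N M) ⊆ {z | φ z = φ (e N SineCurve.top)} := by
      refine closure_minimal (iUnion_subset fun M z hz => ?_) (isClosed_eq hφ continuous_const)
      have h0 : e N SineCurve.top ∈ segment e N M := mem_segment (Nat.zero_le M) _
      exact injOn_barCoord (htail _ (segment_subset_tail N M hz))
        (htail _ (segment_subset_tail N M h0))
        (le_antisymm (not_lt.1 (hnlt M _ h0 z hz)) (not_lt.1 (hnlt M z hz _ h0)))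
    exact fun z hz => hsub (h.tail_subset_closure N hz)
  obtain ⟨n, hn⟩ := hrare {e N SineCurve.top} isCompact_singleton
    (fun hs => h.notMem _ _ (mem_singleton_iff.1 hs).symm)
  obtain ⟨k, hk, z, hz, hkz⟩ := hoften n
  exact hn k hk _ rfl (hconst z hz ▸ hkz)

end SineChain

/-! ### The product is not an `𝓐𝓕`-space -/

section Product

theorem exists_factor_of_isOpenEmbedding {X Z W : Type*} [TopologicalSpace X] [TopologicalSpace Z]
    [TopologicalSpace W] [PreconnectedSpace X] {ι : Z → W} (hι : IsOpenEmbedding ι)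
    (hclosed : IsClosed (range ι)) {f : X → W} (hf : Continuous f) {u : X} (hu : f u ∈ range ι) :
    ∃ g : X → Z, Continuous g ∧ ∀ u, f u = ι (g u) := by
  have hclopen : IsClopen (f ⁻¹' range ι) :=
    ⟨hclosed.preimage hf, hι.isOpen_range.preimage hf⟩
  have huniv := hclopen.eq_univ ⟨u, hu⟩
  have hmem : ∀ v, f v ∈ range ι := fun v => (huniv ▸ mem_univ v : v ∈ f ⁻¹' range ι)
  choose g hg using hmem
  refine ⟨g, hι.isInducing.continuous_iff.2 ?_, fun v => (hg v).symm⟩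
  have : ι ∘ g = f := funext hg
  rwa [this]

variable {X Y : Type*} [TopologicalSpace X] [TopologicalSpace Y]

theorem isOpenEmbedding_inl_inr :
    IsOpenEmbedding (fun x : X => ((Sum.inl x, Sum.inr ()) : (X ⊕ Unit) × (Y ⊕ Unit))) :=
  (IsOpenEmbedding.inl.prodMap IsOpenEmbedding.inr).comp
    (Homeomorph.prodPUnit X).symm.isOpenEmbedding

theorem isOpenEmbedding_inr_inl :
    IsOpenEmbedding (fun y : Y => ((Sum.inr (), Sum.inl y) : (X ⊕ Unit) × (Y ⊕ Unit))) :=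
  (Homeomorph.prodComm (Y ⊕ Unit) (X ⊕ Unit)).isOpenEmbedding.comp isOpenEmbedding_inl_inr

theorem isClosed_range_inl_inr :
    IsClosed (range fun x : X => ((Sum.inl x, Sum.inr ()) : (X ⊕ Unit) × (Y ⊕ Unit))) := by
  convert (isClosed_range_inl (X := X) (Y := Unit)).prod
    (isClosed_range_inr (X := Y) (Y := Unit)) using 1
  ext ⟨p, q⟩
  constructor
  · rintro ⟨z, hz⟩
    rw [Prod.mk.injEq] at hz
    exact ⟨⟨_, hz.1⟩, ⟨_, hz.2⟩⟩
  · rintro ⟨⟨z, hz⟩, ⟨z', hz'⟩⟩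
    exact ⟨z, Prod.ext hz hz'⟩

theorem isClosed_range_inr_inl :
    IsClosed (range fun y : Y => ((Sum.inr (), Sum.inl y) : (X ⊕ Unit) × (Y ⊕ Unit))) := by
  convert (isClosed_range_inr (X := X) (Y := Unit)).prod
    (isClosed_range_inl (X := Y) (Y := Unit)) using 1
  ext ⟨p, q⟩
  constructor
  · rintro ⟨z, hz⟩
    rw [Prod.mk.injEq] at hz
    exact ⟨⟨_, hz.1⟩, ⟨_, hz.2⟩⟩
  · rintro ⟨⟨z, hz⟩, ⟨z', hz'⟩⟩
    exact ⟨z', Prod.ext hz hz'⟩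

theorem SineChain.not_isAFSpace_prod [T2Space Y] {e : ℕ → closedSineCurve → Y}
    {d : ℕ → closedSineCurve} {s : Y} (h : SineChain e d s) :
    ¬ IsAFSpace ((extendedSineCurve ⊕ Unit) × (Y ⊕ Unit)) := by
  intro hAF
  have := preconnectedSpace_extendedSineCurve
  have := h.preconnectedSpace
  let ι : extendedSineCurve → (extendedSineCurve ⊕ Unit) × (Y ⊕ Unit) :=
    fun x => (Sum.inl x, Sum.inr ())
  let κ : Y → (extendedSineCurve ⊕ Unit) × (Y ⊕ Unit) := fun y => (Sum.inr (), Sum.inl y)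
  have hι : IsOpenEmbedding ι := isOpenEmbedding_inl_inr
  have hκ : IsOpenEmbedding κ := isOpenEmbedding_inr_inl
  have hιc : IsClosed (range ι) := isClosed_range_inl_inr
  have hκc : IsClosed (range κ) := isClosed_range_inr_inl
  have hne : ∀ u y, ι u ≠ κ y := fun u y heq => by simp [ι, κ] at heq
  set A : Set ((extendedSineCurve ⊕ Unit) × (Y ⊕ Unit)) := ι '' extendedBar ∪ {κ s} with hA
  have hAclosed : IsClosed A := by
    refine ((IsClosedEmbedding.mk hι.isEmbedding hιc).isClosedMap _ isClosed_extendedBar).union ?_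
    exact isClosed_singleton
  have hιA : ∀ u, ι u ∈ A ↔ u ∈ extendedBar := by
    intro u
    constructor
    · rintro (⟨v, hv, hvu⟩ | hu)
      · exact hι.injective hvu ▸ hv
      · exact absurd hu (hne u s)
    · exact fun hu => Or.inl ⟨u, hu, rfl⟩
  have hκA : ∀ y, κ y ∈ A ↔ y = s := by
    intro y
    constructor
    · rintro (⟨v, hv, hvu⟩ | hy)
      · exact absurd hvu (hne v y)
      · exact hκ.injective hy
    · rintro rfl
      exact Or.inr rfl
  obtain ⟨f, hf, w, hw⟩ : IsAlphaLimitSet A :=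
    (Set.ext_iff.1 hAF A).2 hAclosed
  have hfA : MapsTo f A A := hw ▸ mapsTo_alphaLimit hf
  have hrange : ∀ z ∈ A, z ∈ range ι ∨ z ∈ range κ := by
    rintro z (⟨u, -, rfl⟩ | rfl)
    · exact Or.inl ⟨u, rfl⟩
    · exact Or.inr ⟨s, rfl⟩
  have hιtop : ι (sineInclusion SineCurve.top) ∈ A := (hιA _).2 sineInclusion_top_mem
  have hκs : κ s ∈ A := (hκA s).2 rfl
  have hιoften : ∀ n, ∃ k, n ≤ k ∧ ∃ u, f^[k] (ι u) = w := by
    intro n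
    have hmem := hιtop
    rw [hw, mem_alphaLimit] at hmem
    obtain ⟨k, hk, _, ⟨u, rfl⟩, hux⟩ := hmem _ (hι.isOpen_range.mem_nhds ⟨_, rfl⟩) n
    exact ⟨k, hk, u, hux⟩
  rcases hrange _ (hfA hιtop) with hX | hX
  · obtain ⟨g, hg, hfg⟩ := exists_factor_of_isOpenEmbedding hι hιc (hf.comp hι.continuous) hX
    have hιk : ∀ k u, f^[k] (ι u) = ι (g^[k] u) := fun k u =>
      ((show Function.Semiconj ι g f from fun u => (hfg u).symm).iterate_right k u).symm
    obtain ⟨x, rfl⟩ : ∃ x, w = ι x := by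
      obtain ⟨k, -, u, hu⟩ := hιoften 0
      exact ⟨_, by rw [← hu, hιk]⟩
    rcases hrange _ (hfA hκs) with hY | hY
    · obtain ⟨φ, hφ, hfφ⟩ := exists_factor_of_isOpenEmbedding hι hιc (hf.comp hκ.continuous) hY
      have hα : alphaLimit g x = extendedBar := by
        rw [← preimage_alphaLimit_of_isOpenEmbedding hι hfg x, ← hw]
        ext u
        exact hιA u
      have hκk : ∀ k y, f^[k + 1] (κ y) = ι (g^[k] (φ y)) := by
        intro k y
        rw [Function.iterate_succ_apply, show f (κ y) = ι (φ y) from hfφ y, hιk]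
      refine h.false_of_accSet_eq_limit hg hα hφ ?_ ?_
      · rw [← hιA, ← hfφ]
        exact hfA hκs
      · ext y
        rw [mem_singleton_iff, ← hκA, hw, mem_accSet, mem_alphaLimit]
        constructor
        · intro hy U hU n
          obtain ⟨k, hk, z, hz, hzx⟩ := hy (κ ⁻¹' U) (hκ.continuous.continuousAt hU) n
          refine ⟨k + 1, by omega, κ z, hz, ?_⟩
          rw [hκk]
          exact congrArg ι hzx
        · intro hy U hU n
          obtain ⟨k, hk, _, ⟨z, hz, rfl⟩, hzx⟩ := hy (κ '' U) (hκ.isOpenMap.image_mem_nhds hU)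
            (n + 1)
          obtain ⟨m, rfl⟩ : ∃ m, k = m + 1 := ⟨k - 1, by omega⟩
          rw [hκk] at hzx
          exact ⟨m, by omega, z, hz, hι.injective hzx⟩
    -- Here the copy of `Y` would be invariant, so none of its points could reach `w`, which lies in
    -- the copy of `X`; yet `κ s` is in `A`.
    · obtain ⟨g', -, hfg'⟩ := exists_factor_of_isOpenEmbedding hκ hκc (hf.comp hκ.continuous) hY
      have hmem := hκs
      rw [hw, mem_alphaLimit] at hmem
      obtain ⟨k, -, _, ⟨y, rfl⟩, hy⟩ := hmem _ (hκ.isOpen_range.mem_nhds ⟨_, rfl⟩) 0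
      have hk := ((show Function.Semiconj κ g' f from fun u => (hfg' u).symm).iterate_right k y)
      rw [hy] at hk
      exact hne _ _ hk.symm
  · obtain ⟨φ, hφ, hfφ⟩ := exists_factor_of_isOpenEmbedding hκ hκc (hf.comp hι.continuous) hX
    have hφs : ∀ u, φ u = s := h.eq_limit_of_map_extendedBar hφ fun u hu => by
      rw [← hκA, ← hfφ]
      exact hfA ((hιA u).2 hu)
    -- After one step all points of the copy of `X` share one orbit, so each of them is a preimage
    -- of `w` as often as any other, including the endpoint, which is not in `A`.
    have hconst : ∀ u, f (ι u) = κ s := fun u => (hfφ u).trans (congrArg κ (hφs u))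
    have hmem : ι (sineInclusion SineCurve.endpoint) ∈ A := by
      rw [hw, mem_alphaLimit]
      intro U hU n
      obtain ⟨k, hk, u, hu⟩ := hιoften (n + 1)
      obtain ⟨m, rfl⟩ : ∃ m, k = m + 1 := ⟨k - 1, by omega⟩
      refine ⟨m + 1, by omega, _, mem_of_mem_nhds hU, ?_⟩
      rw [Function.iterate_succ_apply, hconst] at hu ⊢
      exact hu
    exact sineInclusion_endpoint_notMem ((hιA _).1 hmem)

end Product

end

theorem theorem4p4 :
    -- the extended sine curve plus a point is a compact metrizable AF-space
    (CompactSpace (extendedSineCurve ⊕ Unit) ∧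
      TopologicalSpace.MetrizableSpace (extendedSineCurve ⊕ Unit) ∧
      IsAFSpace (extendedSineCurve ⊕ Unit)) ∧
    -- chains of sine curves exist, even in the plane
    (∃ Y : Set (ℝ × ℝ), IsChainOfSineCurves Y) ∧
    -- any chain of sine curves plus a point is a compact metrizable AF-space, and its product
    -- with the extended sine curve plus a point is not an AF-space
    (∀ (Y : Type*) [TopologicalSpace Y], IsChainOfSineCurves Y →
      (CompactSpace (Y ⊕ Unit) ∧
        TopologicalSpace.MetrizableSpace (Y ⊕ Unit) ∧
        IsAFSpace (Y ⊕ Unit)) ∧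
      ¬ IsAFSpace ((extendedSineCurve ⊕ Unit) × (Y ⊕ Unit))) := by
  have : CompactSpace extendedSineCurve :=
    isCompact_iff_compactSpace.1 isCompact_extendedSineCurve
  have : Nonempty extendedSineCurve := ⟨sineInclusion SineCurve.top⟩
  refine ⟨⟨inferInstance, inferInstance, isAFSpace_sum_unit isFixedAlphaLimitSet_extended⟩,
    ⟨planarChain, isChainOfSineCurves_planarChain⟩, fun Y _ hY => ?_⟩
  obtain ⟨hT2, e, d, s, h⟩ := hY.exists_sineChain
  have := h.compactSpace
  have := h.metrizableSpace
  have : Nonempty Y := ⟨s⟩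
  exact ⟨⟨inferInstance, inferInstance, isAFSpace_sum_unit h.isFixedAlphaLimitSet⟩,
    h.not_isAFSpace_prod⟩
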